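/- Let $U\subset\mathbb R^2$ be a connected non-empty open set with two smooth orthogonal nets $\mathcal N_1,\mathcal N_2$ (each consisting of two mutually orthogonal foliations of $U$), whose four foliations $\mathcal F_1,\dots,\mathcal F_4$ are pairwise transverse at every point of $U$, so that they form a 4-web. An Abelian relation of this web is a 4-tuple $(\omega_1,\dots,\omega_4)$ of smooth closed 1-forms on $U$ such that $\omega_i$ vanishes along the leaves of $\mathcal F_i$ and $\sum_i\omega_i=0$. Assume that the web has maximal rank, i.e. that its real vector space of Abelian relations has dimension $3$, and that $\mathcal N_1$ is conformally flat, i.e. that in a neighbourhood of every point of $U$ its two foliations are the coordinate lines $u=\mathrm{const}$, $v=\mathrm{const}$ of some isothermal coordinates $(u,v)$ ($u+iv$ is a holomorphic function of $x+iy$ with non-vanishing derivative). Then: 1. $\mathcal N_2$ is also conformally flat. 2. The rank quartic of the web exists and splits into two conics. That is, let $(\omega_i^{\alpha})_{i=1}^4$, $\alpha=1,2,3$, be any basis of the space of Abelian relations, write locally $\omega_i^\alpha=x_i^\alpha\,ds_i$ with $s_i$ a first integral of $\mathcal F_i$ with $ds_i\neq 0$, and consider the four arcs in the real projective plane $\mathbb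 P^2$ traced by the points $[x_i^1:x_i^2:x_i^3]$, $i=1,\dots,4$. Then there is, up to a non-zero constant factor, exactly one non-zero real homogeneous polynomial $F$ of degree $4$ in three variables that vanishes on all four arcs, and $F=Q_1Q_2$ with non-zero real quadratic forms $Q_1,Q_2$ (the conics may be degenerate). -/

import Mathlib

open scoped ContDiff

/-- A field of directions in the Euclidean plane `ℂ = ℝ²`: the line `D p` is the tangent direction
at `p` of the leaf through `p`. Only the values on the domain under consideration matter. -/
abbrev DirectionField : Type := ℂ → Submodule ℝ ℂ

/-- `D` is the field of tangent directions of a smooth foliation of `U`: locally it is the kernel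
of a smooth nowhere vanishing differential 1-form `η`, i.e. the leaves are the integral curves of
`η = 0`. (The form is only local, so that the foliation need not be co-orientable.) -/
def IsFoliation (U : Set ℂ) (D : DirectionField) : Prop :=
  ∀ p ∈ U, ∃ V : Set ℂ, IsOpen V ∧ p ∈ V ∧ V ⊆ U ∧ ∃ η : ℂ → ℂ →L[ℝ] ℝ,
    ContDiffOn ℝ ∞ η V ∧ ∀ q ∈ V, η q ≠ 0 ∧ ∀ v : ℂ, v ∈ D q ↔ η q v = 0

/-- A `d`-web: `d` foliations, pairwise transverse at every point of `U`. -/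
structure IsWeb (U : Set ℂ) {d : ℕ} (W : Fin d → DirectionField) : Prop where
  foliation : ∀ i, IsFoliation U (W i)
  transverse : ∀ p ∈ U, ∀ i j, i ≠ j → W i p ≠ W j p

/-- An orthogonal net: two foliations whose leaves meet at right angles. -/
structure IsOrthogonalNet (U : Set ℂ) (N : Fin 2 → DirectionField) : Prop where
  foliation : ∀ i, IsFoliation U (N i)
  orthogonal : ∀ p ∈ U, N 0 p ⟂ N 1 p

/-- A net is conformally flat if locally it is the net of coordinate lines `u = const`,
`v = const` of isothermal coordinates `u + iv = g`, where `g` is holomorphic with `g' ≠ 0`.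
Along a vector `w` the differentials of `u`, `v` are the real and imaginary parts of `g' w`. -/
def IsConformallyFlat (U : Set ℂ) (N : Fin 2 → DirectionField) : Prop :=
  ∀ p ∈ U, ∃ V : Set ℂ, IsOpen V ∧ p ∈ V ∧ V ⊆ U ∧ ∃ g : ℂ → ℂ,
    DifferentiableOn ℂ g V ∧ ∀ q ∈ V, deriv g q ≠ 0 ∧
      (∀ w : ℂ, w ∈ N 0 q ↔ (deriv g q * w).re = 0) ∧
      (∀ w : ℂ, w ∈ N 1 q ↔ (deriv g q * w).im = 0)

/-- The real vector space of Abelian relations on `U` of a web: tuples of smooth closed 1-forms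
`θ i` on `U` which vanish along the leaves of the `i`-th foliation and have sum zero.
A form on `U` is represented by its extension by zero to the whole plane. -/
def abelianRelations (U : Set ℂ) {d : ℕ} (W : Fin d → DirectionField) (hU : IsOpen U) :
    Submodule ℝ (Fin d → ℂ → ℂ →L[ℝ] ℝ) where
  carrier := {θ |
    (∀ i, ContDiffOn ℝ ∞ (θ i) U) ∧
    (∀ i, ∀ p, p ∉ U → θ i p = 0) ∧
    (∀ i, ∀ p ∈ U, ∀ v ∈ W i p, θ i p v = 0) ∧
    (∀ i, ∀ p ∈ U, ∀ v w : ℂ, fderiv ℝ (θ i) p v w = fderiv ℝ (θ i) p w v) ∧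
    (∀ p ∈ U, ∑ i, θ i p = 0)}
  zero_mem' := by
    refine ⟨fun i => contDiffOn_const, ?_, ?_, ?_, ?_⟩ <;> simp
  add_mem' := by
    rintro θ τ ⟨h1, h2, h3, h4, h5⟩ ⟨k1, k2, k3, k4, k5⟩
    refine ⟨fun i => (h1 i).add (k1 i), fun i p hp => ?_, fun i p hp v hv => ?_,
      fun i p hp v w => ?_, fun p hp => ?_⟩
    · simp [h2 i p hp, k2 i p hp]
    · simp [h3 i p hp v hv, k3 i p hp v hv]
    · have d1 : DifferentiableAt ℝ (θ i) p :=
        ((h1 i).contDiffAt (hU.mem_nhds hp)).differentiableAt (by simp)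
      have d2 : DifferentiableAt ℝ (τ i) p :=
        ((k1 i).contDiffAt (hU.mem_nhds hp)).differentiableAt (by simp)
      have e : fderiv ℝ ((θ + τ) i) p = fderiv ℝ (θ i) p + fderiv ℝ (τ i) p :=
        fderiv_add d1 d2
      rw [e]; simp [h4 i p hp v w, k4 i p hp v w]
    · simp [Finset.sum_add_distrib, h5 p hp, k5 p hp]
  smul_mem' := by
    rintro c θ ⟨h1, h2, h3, h4, h5⟩
    refine ⟨fun i => (h1 i).const_smul c, fun i p hp => ?_, fun i p hp v hv => ?_,
      fun i p hp v w => ?_, fun p hp => ?_⟩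
    · simp [h2 i p hp]
    · simp [h3 i p hp v hv]
    · have d1 : DifferentiableAt ℝ (θ i) p :=
        ((h1 i).contDiffAt (hU.mem_nhds hp)).differentiableAt (by simp)
      have e : fderiv ℝ ((c • θ) i) p = c • fderiv ℝ (θ i) p := fderiv_const_smul d1 c
      rw [e]; simp [h4 i p hp v w]
    · simp [← Finset.smul_sum, h5 p hp]

/-- The rank of a web on `U`: the dimension of its space of Abelian relations. -/
noncomputable def webRank (U : Set ℂ) {d : ℕ} (W : Fin d → DirectionField) (hU : IsOpen U) : ℕ :=
  Module.finrank ℝ (abelianRelations U W hU)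

/-- The 4-web formed by two nets. -/
def webOfNets (N₁ N₂ : Fin 2 → DirectionField) : Fin 4 → DirectionField :=
  ![N₁ 0, N₁ 1, N₂ 0, N₂ 1]

/-- `F = 0` is an equation of a plane quartic containing the four rank arcs of a 4-web of rank 3.
Given a basis `b 0, b 1, b 2` of the Abelian relations, the three `i`-th components at a point `p`
are multiples of one covector annihilating the leaf, `(b α) i p = x α • ds`; the `i`-th arc is
traced by the points `[x 0 : x 1 : x 2]` of the projective plane. As `v` varies, the vectors
`α ↦ (b α) i p v` below are exactly the multiples of the vector `x`. -/
def IsRankQuartic (U : Set ℂ) (W : Fin 4 → DirectionField) (hU : IsOpen U)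
    (b : Module.Basis (Fin 3) ℝ (abelianRelations U W hU)) (F : MvPolynomial (Fin 3) ℝ) : Prop :=
  F.IsHomogeneous 4 ∧ F ≠ 0 ∧
    ∀ i, ∀ p ∈ U, ∀ v : ℂ,
      MvPolynomial.eval (fun α : Fin 3 => (b α : Fin 4 → ℂ → ℂ →L[ℝ] ℝ) i p v) F = 0

/-- `Q = 0` is an equation of a (possibly degenerate) plane conic. -/
def IsConic (Q : MvPolynomial (Fin 3) ℝ) : Prop :=
  Q.IsHomogeneous 2 ∧ Q ≠ 0

/-!
Work near a point in isothermal coordinates `u + iv = g` of the first net, so that an Abelian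
relation has `θ 0 = a du` and `θ 1 = b dv` with `a = a(u)`, `b = b(v)`. The pair `(θ 2, θ 3)` is the
orthogonal decomposition of `-(a du + b dv)` with respect to the second net. As the sum `θ 2 + θ 3`
is closed anyway, the only condition is that `θ 2 - θ 3` is closed, which reads
`a' + Xa = b' + Yb` with functions `X`, `Y` given by the angle `φ` between the nets
(`IsAdaptedChart.frameJet_eq`). Denote this common value by `y`. Then `(a, b, y)` satisfies
the linear system
`∂ᵤa = y - Xa`, `∂ᵥa = 0`, `∂ᵤb = 0`, `∂ᵥb = y - Yb`, `∂ᵤy = Yᵤ b`, `∂ᵥy = Xᵥ a`,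
so the relation is determined by the value of `(a, b, y)` at one point
(`IsAdaptedChart.eq_zero_of_jet`). Rank three means that every value is taken, and therefore the
system is compatible: `Xᵥ = Yᵤ =: K`, `Kᵤ = KX`, `Kᵥ = KY` (`IsAdaptedChart.compatibility`).

The equation `Xᵥ = Yᵤ` says that `φ` is harmonic. Concretely, if `dM = X du + Y dv`, then
`e^M (cot 2φ + i)` is holomorphic (`IsAdaptedChart.exists_holomorphic_twist`), and dividing `g'` by
its square root gives the derivative of isothermal coordinates of the second net
(`isConformallyFlat_second_net`).

Evaluation of `a`, `b`, `y` on a basis of relations gives a moving frame `x₀, x₁, y` of `ℝ³`, in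
which `x₀`, `x₁` trace the first two arcs. The quadratic form with `⟨x₀, x₁⟩ = 1`,
`⟨y, y⟩ = -K` and all other products zero is constant up to a factor: the defects from these
relations satisfy a linear system, so they vanish everywhere if they vanish at one point
(`exists_conic_of_first_net`). Since the second net is conformally flat too, the other two arcs lie
on a conic for the same reason.

The quartic is unique because the four points over `p` are distinct and lie on the line given by the
relation `λ` that vanishes at `p`. A quartic through the arcs and a fifth point of the line contains
the line; the remaining cubic factor still vanishes on the arcs, since no component of `λ` vanishes
identically near `p`, so it contains the line again, and so on until it is zero
(`eq_zero_of_degree_le_three`, `exists_point_quartic_eq_zero`).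
-/

open Complex Set Filter Topology

/-! ### Differentiation along a holomorphic frame -/

/-- The derivative of `f` along the vector field `c / h`. If `h` is the derivative of a holomorphic
function `g = u + iv`, then `c = 1` and `c = I` give the partial derivatives with respect to `u`
and to `v`. -/
noncomputable def frameDeriv (h : ℂ → ℂ) (c : ℂ) (f : ℂ → ℝ) (p : ℂ) : ℝ :=
  fderiv ℝ f p (c / h p)

section Frame

variable {V : Set ℂ} {h : ℂ → ℂ}

lemma differentiableAt_of_contDiffOn {E F : Type*} [NormedAddCommGroup E] [NormedSpace ℝ E]
    [NormedAddCommGroup F] [NormedSpace ℝ F] {s : Set E} {f : E → F} {p : E}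
    (hs : IsOpen s) (hf : ContDiffOn ℝ ∞ f s) (hp : p ∈ s) : DifferentiableAt ℝ f p :=
  (hf.contDiffAt (hs.mem_nhds hp)).differentiableAt (by simp)

lemma contDiffOn_const_div (hV : IsOpen V) (hh : DifferentiableOn ℂ h V) (h0 : ∀ p ∈ V, h p ≠ 0)
    (c : ℂ) : ContDiffOn ℝ ∞ (fun p => c / h p) V := by
  have : DifferentiableOn ℂ (fun p => c / h p) V := (differentiableOn_const c).div hh h0
  exact (this.contDiffOn hV).restrict_scalars ℝ

lemma contDiffOn_frame_apply (hV : IsOpen V) (hh : DifferentiableOn ℂ h V)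
    (h0 : ∀ p ∈ V, h p ≠ 0) {θ : ℂ → ℂ →L[ℝ] ℝ} (hθ : ContDiffOn ℝ ∞ θ V) (c : ℂ) :
    ContDiffOn ℝ ∞ (fun p => θ p (c / h p)) V :=
  hθ.clm_apply (contDiffOn_const_div hV hh h0 c)

lemma contDiffOn_frameDeriv (hV : IsOpen V) (hh : DifferentiableOn ℂ h V)
    (h0 : ∀ p ∈ V, h p ≠ 0) {f : ℂ → ℝ} (hf : ContDiffOn ℝ ∞ f V) (c : ℂ) :
    ContDiffOn ℝ ∞ (frameDeriv h c f) V :=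
  contDiffOn_frame_apply hV hh h0 (hf.fderiv_of_isOpen hV (by simp)) c

lemma frameDeriv_congr (hV : IsOpen V) {f g : ℂ → ℝ} (hfg : EqOn f g V) (c : ℂ) {p : ℂ}
    (hp : p ∈ V) : frameDeriv h c f p = frameDeriv h c g p := by
  have : f =ᶠ[𝓝 p] g := hfg.eventuallyEq_of_mem (hV.mem_nhds hp)
  simp only [frameDeriv, this.fderiv_eq]

lemma frameDeriv_add {f g : ℂ → ℝ} {p : ℂ} (hf : DifferentiableAt ℝ f p)
    (hg : DifferentiableAt ℝ g p) (c : ℂ) :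
    frameDeriv h c (fun q => f q + g q) p = frameDeriv h c f p + frameDeriv h c g p := by
  simp [frameDeriv, fderiv_fun_add hf hg]

lemma frameDeriv_sub {f g : ℂ → ℝ} {p : ℂ} (hf : DifferentiableAt ℝ f p)
    (hg : DifferentiableAt ℝ g p) (c : ℂ) :
    frameDeriv h c (fun q => f q - g q) p = frameDeriv h c f p - frameDeriv h c g p := by
  simp [frameDeriv, fderiv_fun_sub hf hg]

lemma frameDeriv_mul {f g : ℂ → ℝ} {p : ℂ} (hf : DifferentiableAt ℝ f p)
    (hg : DifferentiableAt ℝ g p) (c : ℂ) :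
    frameDeriv h c (fun q => f q * g q) p
      = frameDeriv h c f p * g p + f p * frameDeriv h c g p := by
  simp [frameDeriv, fderiv_fun_mul hf hg]; ring

lemma frameDeriv_const_mul {f : ℂ → ℝ} {p : ℂ} (hf : DifferentiableAt ℝ f p) (r : ℝ) (c : ℂ) :
    frameDeriv h c (fun q => r * f q) p = r * frameDeriv h c f p := by
  simp [frameDeriv, fderiv_const_mul hf]

lemma frameDeriv_const (r : ℝ) (c : ℂ) (p : ℂ) : frameDeriv h c (fun _ => r) p = 0 := by
  simp [frameDeriv]

lemma frameDeriv_sum {ι : Type*} (s : Finset ι) {f : ι → ℂ → ℝ} {p : ℂ}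
    (hf : ∀ i ∈ s, DifferentiableAt ℝ (f i) p) (c : ℂ) :
    frameDeriv h c (fun q => ∑ i ∈ s, f i q) p = ∑ i ∈ s, frameDeriv h c (f i) p := by
  simp [frameDeriv, fderiv_fun_sum hf]

/-- Since `h` is holomorphic, the correction term is symmetric in `c` and `d`: the fields `c / h`
and `d / h` commute. -/
lemma frameDeriv_form_apply (hV : IsOpen V) (hh : DifferentiableOn ℂ h V) (h0 : ∀ p ∈ V, h p ≠ 0)
    {θ : ℂ → ℂ →L[ℝ] ℝ} {p : ℂ} (hp : p ∈ V) (hθ : DifferentiableAt ℝ θ p) (c d : ℂ) :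
    frameDeriv h c (fun q => θ q (d / h q)) p
      = fderiv ℝ θ p (c / h p) (d / h p) + θ p (-(c * d * deriv h p) / h p ^ 3) := by
  have hd : HasDerivAt (fun q => d / h q) (-(d * deriv h p) / h p ^ 2) p := by
    have := (hasDerivAt_const p d).div
      ((hh.differentiableAt (hV.mem_nhds hp)).hasDerivAt) (h0 p hp)
    rw [zero_mul, zero_sub] at this
    exact this
  have hd' : HasFDerivAt (fun q => d / h q) _ p := hd.hasFDerivAt.restrictScalars ℝ
  have := hθ.hasFDerivAt.clm_apply hd'
  simp only [frameDeriv, this.fderiv]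
  simp only [add_apply, ContinuousLinearMap.comp_apply,
    ContinuousLinearMap.flip_apply, ContinuousLinearMap.coe_restrictScalars',
    ContinuousLinearMap.toSpanSingleton_apply, smul_eq_mul]
  rw [add_comm]
  congr 2
  have := h0 p hp
  field_simp

lemma frameDeriv_closed (hV : IsOpen V) (hh : DifferentiableOn ℂ h V) (h0 : ∀ p ∈ V, h p ≠ 0)
    {θ : ℂ → ℂ →L[ℝ] ℝ} {p : ℂ} (hp : p ∈ V) (hθ : DifferentiableAt ℝ θ p)
    (hcl : ∀ v w : ℂ, fderiv ℝ θ p v w = fderiv ℝ θ p w v) (c d : ℂ) :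
    frameDeriv h c (fun q => θ q (d / h q)) p = frameDeriv h d (fun q => θ q (c / h q)) p := by
  rw [frameDeriv_form_apply hV hh h0 hp hθ, frameDeriv_form_apply hV hh h0 hp hθ, hcl, mul_comm c d]

lemma frameDeriv_comm (hV : IsOpen V) (hh : DifferentiableOn ℂ h V) (h0 : ∀ p ∈ V, h p ≠ 0)
    {f : ℂ → ℝ} (hf : ContDiffOn ℝ ∞ f V) {p : ℂ} (hp : p ∈ V) (c d : ℂ) :
    frameDeriv h c (frameDeriv h d f) p = frameDeriv h d (frameDeriv h c f) p := by
  have hf' : ContDiffOn ℝ ∞ (fderiv ℝ f) V := hf.fderiv_of_isOpen hV (by simp)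
  refine frameDeriv_closed hV hh h0 hp (differentiableAt_of_contDiffOn hV hf' hp) ?_ c d
  intro v w
  have : IsSymmSndFDerivAt ℝ f p :=
    (hf.contDiffAt (hV.mem_nhds hp)).isSymmSndFDerivAt (by
      simp only [minSmoothness_of_isRCLikeNormedField]
      exact WithTop.coe_le_coe.2 (le_top : (2 : ℕ∞) ≤ ⊤))
  exact this v w

lemma apply_frame (L : ℂ →L[ℝ] ℝ) {z : ℂ} (hz : z ≠ 0) (w : ℂ) :
    L w = (z * w).re * L (1 / z) + (z * w).im * L (I / z) := by
  have : w = (z * w).re • (1 / z) + (z * w).im • (I / z) := by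
    rw [real_smul, real_smul, mul_div, mul_div, ← add_div, mul_one, re_add_im,
      mul_div_cancel_left₀ _ hz]
  conv_lhs => rw [this]
  rw [map_add, map_smul, map_smul, smul_eq_mul, smul_eq_mul]

lemma apply_of_re_ker (L : ℂ →L[ℝ] ℝ) {z : ℂ} (hz : z ≠ 0)
    (hL : ∀ w : ℂ, (z * w).re = 0 → L w = 0) (w : ℂ) : L w = (z * w).re * L (1 / z) := by
  rw [apply_frame L hz w, hL (I / z) (by rw [mul_div_cancel₀ _ hz]; simp)]; simp

lemma apply_of_im_ker (L : ℂ →L[ℝ] ℝ) {z : ℂ} (hz : z ≠ 0)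
    (hL : ∀ w : ℂ, (z * w).im = 0 → L w = 0) (w : ℂ) : L w = (z * w).im * L (I / z) := by
  rw [apply_frame L hz w, hL (1 / z) (by rw [mul_div_cancel₀ _ hz]; simp)]; simp

/-- Poincaré's lemma for `X du + Y dv`, where `du + i dv = h dz`. -/
lemma exists_primitive_of_frame (hV : IsOpen V) (hc : Convex ℝ V) (hh : DifferentiableOn ℂ h V)
    (h0 : ∀ p ∈ V, h p ≠ 0) {X Y : ℂ → ℝ} (hX : ContDiffOn ℝ ∞ X V) (hY : ContDiffOn ℝ ∞ Y V)
    (hcl : ∀ p ∈ V, frameDeriv h I X p = frameDeriv h 1 Y p) :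
    ∃ M : ℂ → ℝ, ∀ p ∈ V, DifferentiableAt ℝ M p ∧ frameDeriv h 1 M p = X p ∧
      frameDeriv h I M p = Y p := by
  set η : ℂ → ℂ →L[ℝ] ℝ := fun p =>
    X p • reCLM.comp (ContinuousLinearMap.mul ℝ ℂ (h p))
      + Y p • imCLM.comp (ContinuousLinearMap.mul ℝ ℂ (h p)) with hη
  have e1 : EqOn (fun q => η q (1 / h q)) X V := fun q hq => by
    simp [hη, mul_inv_cancel₀ (h0 q hq)]
  have eI : EqOn (fun q => η q (I / h q)) Y V := fun q hq => by
    simp only [hη, add_apply, smul_apply, ContinuousLinearMap.comp_apply,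
      ContinuousLinearMap.mul_apply', mul_div_cancel₀ _ (h0 q hq)]
    simp
  have hd : ∀ p ∈ V, DifferentiableAt ℝ η p := by
    intro p hp
    have d1 := differentiableAt_of_contDiffOn hV hX hp
    have d2 := differentiableAt_of_contDiffOn hV hY hp
    have d3 : DifferentiableAt ℝ h p :=
      (hh.differentiableAt (hV.mem_nhds hp)).restrictScalars ℝ
    have d4 : DifferentiableAt ℝ (fun p => ContinuousLinearMap.mul ℝ ℂ (h p)) p :=
      (ContinuousLinearMap.mul ℝ ℂ).differentiableAt.comp p d3
    exact (d1.smul ((differentiableAt_const _).clm_comp d4)).add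
      (d2.smul ((differentiableAt_const _).clm_comp d4))
  have hsymm : ∀ p ∈ V, ∀ v w, fderiv ℝ η p v w = fderiv ℝ η p w v := by
    intro p hp v w
    have key := hcl p hp
    rw [← frameDeriv_congr hV e1 I hp, ← frameDeriv_congr hV eI 1 hp,
      frameDeriv_form_apply hV hh h0 hp (hd p hp), frameDeriv_form_apply hV hh h0 hp (hd p hp),
      mul_one, one_mul, add_left_inj] at key
    have ev : ∀ v w, fderiv ℝ η p v w
        = (h p * v).re * ((h p * w).re * fderiv ℝ η p (1 / h p) (1 / h p)
            + (h p * w).im * fderiv ℝ η p (1 / h p) (I / h p))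
          + (h p * v).im * ((h p * w).re * fderiv ℝ η p (I / h p) (1 / h p)
            + (h p * w).im * fderiv ℝ η p (I / h p) (I / h p)) := by
      intro v w
      rw [← apply_frame _ (h0 p hp) w, ← apply_frame _ (h0 p hp) w]
      exact apply_frame ((fderiv ℝ η p).flip w) (h0 p hp) v
    rw [ev v w, ev w v, key]; ring
  obtain ⟨M, hM⟩ := hc.exists_forall_hasFDerivAt_of_fderiv_symmetric hV
    (fun p hp => (hd p hp).differentiableWithinAt) hsymm
  refine ⟨M, fun p hp => ⟨(hM p hp).differentiableAt, ?_, ?_⟩⟩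
  · rw [frameDeriv, (hM p hp).fderiv]; exact e1 hp
  · rw [frameDeriv, (hM p hp).fderiv]; exact eI hp

/-- The Cauchy–Riemann equations with respect to the frame `1 / h`, `I / h`. -/
lemma differentiableOn_of_frame_cauchyRiemann (h0 : ∀ p ∈ V, h p ≠ 0) {P Q : ℂ → ℝ}
    (hP : ∀ p ∈ V, DifferentiableAt ℝ P p) (hQ : ∀ p ∈ V, DifferentiableAt ℝ Q p)
    (h1 : ∀ p ∈ V, frameDeriv h 1 P p = frameDeriv h I Q p)
    (h2 : ∀ p ∈ V, frameDeriv h I P p = -frameDeriv h 1 Q p) :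
    DifferentiableOn ℂ (fun p => (P p : ℂ) + Q p * I) V := by
  intro p hp
  refine DifferentiableAt.differentiableWithinAt ?_
  have hd : HasFDerivAt (fun p => (P p : ℂ) + Q p * I)
      (ofRealCLM.comp (fderiv ℝ P p) + (ofRealCLM.comp (fderiv ℝ Q p)).smulRight I) p :=
    (ofRealCLM.hasFDerivAt.comp p (hP p hp).hasFDerivAt).add
      ((ofRealCLM.hasFDerivAt.comp p (hQ p hp).hasFDerivAt).mul_const' I)
  rw [differentiableAt_complex_iff_differentiableAt_real]
  refine ⟨hd.differentiableAt, ?_⟩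
  have e1 := h1 p hp
  have e2 := h2 p hp
  simp only [frameDeriv] at e1 e2
  rw [hd.fderiv]
  simp only [add_apply, ContinuousLinearMap.comp_apply, ContinuousLinearMap.smulRight_apply,
    ofRealCLM_apply, smul_eq_mul, apply_frame (fderiv ℝ P p) (h0 p hp) I,
    apply_frame (fderiv ℝ Q p) (h0 p hp) I, apply_frame (fderiv ℝ P p) (h0 p hp) 1,
    apply_frame (fderiv ℝ Q p) (h0 p hp) 1, e1, e2]
  apply Complex.ext
  · simp
  · simp; ring

/-- Unique continuation for a linear system of first order: along a segment the solution satisfies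
a linear differential inequality, to which Grönwall's lemma applies. -/
lemma eqOn_zero_of_linear_system {ι : Type*} [Fintype ι] (hc : Convex ℝ V)
    (hh : ContinuousOn h V) (h0 : ∀ p ∈ V, h p ≠ 0) {f : ι → ℂ → ℝ}
    (hf : ∀ i, ∀ p ∈ V, DifferentiableAt ℝ (f i) p) {A B : ι → ι → ℂ → ℝ}
    (hA : ∀ i j, ContinuousOn (A i j) V) (hB : ∀ i j, ContinuousOn (B i j) V)
    (hfA : ∀ i, ∀ p ∈ V, frameDeriv h 1 (f i) p = ∑ j, A i j p * f j p)
    (hfB : ∀ i, ∀ p ∈ V, frameDeriv h I (f i) p = ∑ j, B i j p * f j p)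
    {p : ℂ} (hp : p ∈ V) (h_init : ∀ i, f i p = 0) : ∀ i, ∀ q ∈ V, f i q = 0 := by
  intro i q hq
  set γ : ℝ → ℂ := fun t => p + t * (q - p) with hγ
  have hγc : Continuous γ := by fun_prop
  have hγV : ∀ t ∈ Icc (0 : ℝ) 1, γ t ∈ V := by
    intro t ht
    have := hc hp hq (sub_nonneg.2 ht.2) ht.1 (by ring)
    convert this using 1
    simp only [hγ, real_smul]; push_cast; ring
  set M : ι → ι → ℝ → ℝ := fun i j t =>
    (h (γ t) * (q - p)).re * A i j (γ t) + (h (γ t) * (q - p)).im * B i j (γ t) with hM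
  have hMc : ∀ i j, ContinuousOn (M i j) (Icc 0 1) := by
    intro i j
    have h1 : ContinuousOn (fun t => h (γ t)) (Icc 0 1) := hh.comp hγc.continuousOn hγV
    have h2 : ContinuousOn (fun t => A i j (γ t)) (Icc 0 1) := (hA i j).comp hγc.continuousOn hγV
    have h3 : ContinuousOn (fun t => B i j (γ t)) (Icc 0 1) := (hB i j).comp hγc.continuousOn hγV
    have h4 : ContinuousOn (fun t => h (γ t) * (q - p)) (Icc 0 1) := h1.mul continuousOn_const
    exact ((continuous_re.comp_continuousOn h4).mul h2).add
      ((continuous_im.comp_continuousOn h4).mul h3)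
  have hb : ∀ i j, ∃ C, ∀ t ∈ Icc (0 : ℝ) 1, ‖M i j t‖ ≤ C := fun i j =>
    isCompact_Icc.exists_bound_of_continuousOn (hMc i j)
  choose C hC using hb
  have hC0 : ∀ i j, 0 ≤ C i j := fun i j =>
    (norm_nonneg _).trans (hC i j 0 (left_mem_Icc.2 zero_le_one))
  have hder : ∀ t ∈ Icc (0 : ℝ) 1, HasDerivAt (fun t => fun i => f i (γ t))
      (fun i => ∑ j, M i j t * f j (γ t)) t := by
    intro t ht
    rw [hasDerivAt_pi]
    intro i
    have h1 : HasDerivAt γ (q - p) t := by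
      have := ((hasDerivAt_id t).ofReal_comp.mul_const (q - p)).const_add p
      rw [ofReal_one, one_mul] at this
      exact this
    have h2 := ((hf i _ (hγV t ht)).hasFDerivAt).comp_hasDerivAt t h1
    refine h2.congr_deriv ?_
    rw [apply_frame _ (h0 _ (hγV t ht))]
    have e1 := hfA i _ (hγV t ht)
    have e2 := hfB i _ (hγV t ht)
    simp only [frameDeriv] at e1 e2
    rw [e1, e2, Finset.mul_sum, Finset.mul_sum, ← Finset.sum_add_distrib]
    exact Finset.sum_congr rfl fun j _ => by simp only [hM]; ring
  have key := eq_zero_of_abs_deriv_le_mul_abs_self_of_eq_zero_right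
    (f := fun t => fun i => f i (γ t)) (f' := fun t => fun i => ∑ j, M i j t * f j (γ t))
    (K := ∑ i, ∑ j, C i j) (a := 0) (b := 1)
    (fun t ht => (hder t ht).continuousAt.continuousWithinAt)
    (fun t ht => (hder t (Ico_subset_Icc_self ht)).hasDerivWithinAt)
    (by ext i; simp [hγ, h_init i])
    (by
      intro t ht
      have ht' := Ico_subset_Icc_self ht
      refine (pi_norm_le_iff_of_nonneg (by
        exact mul_nonneg (Finset.sum_nonneg fun i _ => Finset.sum_nonneg fun j _ => hC0 i j)
          (norm_nonneg _))).2 fun i => ?_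
      refine (norm_sum_le _ _).trans ?_
      calc ∑ j, ‖M i j t * f j (γ t)‖ ≤ ∑ j, C i j * ‖fun i => f i (γ t)‖ := by
            refine Finset.sum_le_sum fun j _ => ?_
            rw [norm_mul]
            exact mul_le_mul (hC i j t ht') (norm_le_pi_norm (fun i => f i (γ t)) j)
              (norm_nonneg _) (hC0 i j)
        _ = (∑ j, C i j) * ‖fun i => f i (γ t)‖ := by rw [Finset.sum_mul]
        _ ≤ _ := by
            refine mul_le_mul_of_nonneg_right ?_ (norm_nonneg _)
            exact Finset.single_le_sum (f := fun i => ∑ j, C i j)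
              (fun i _ => Finset.sum_nonneg fun j _ => hC0 i j) (Finset.mem_univ i))
    1 (right_mem_Icc.2 zero_le_one)
  have := congrFun key i
  simpa [hγ] using this

end Frame

/-- A property that spreads from an open piece to a neighbourhood of every point spreads over a
connected set. -/
lemma forall_mem_of_local_spread {U : Set ℂ} (hc : IsPreconnected U)
    {P : ℂ → Prop}
    (hloc : ∀ p ∈ U, ∃ V : Set ℂ, IsOpen V ∧ p ∈ V ∧
      ((∃ q ∈ V, ∀ᶠ z in 𝓝 q, P z) → ∀ z ∈ V, P z))
    {p₀ : ℂ} (hp₀ : p₀ ∈ U) (h₀ : ∀ᶠ z in 𝓝 p₀, P z) : ∀ p ∈ U, P p := by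
  have hS : IsOpen {q | ∀ᶠ z in 𝓝 q, P z} :=
    isOpen_iff_mem_nhds.2 fun q hq => eventually_eventually_nhds.2 hq
  have hsub : U ⊆ {q | ∀ᶠ z in 𝓝 q, P z} := by
    refine hc.subset_of_closure_inter_subset hS ⟨p₀, hp₀, h₀⟩ ?_
    rintro q ⟨hq, hqU⟩
    obtain ⟨V, hVo, hqV, hV⟩ := hloc q hqU
    obtain ⟨z, hzV, hz⟩ := mem_closure_iff.1 hq V hVo hqV
    exact eventually_of_mem (hVo.mem_nhds hqV) (hV ⟨z, hzV, hz⟩)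
  exact fun p hp => (hsub hp).self_of_nhds

/-! ### Adapted charts -/

/-- `V` is a convex open set on which the first net is given by the real and imaginary parts of the
form `h dz`, with `h` holomorphic, and the second net by those of `k dz`, with `k` smooth. Thus
`h = g'` for isothermal coordinates `g` of the first net. -/
structure IsAdaptedChart (U : Set ℂ) (N₁ N₂ : Fin 2 → DirectionField) (V : Set ℂ)
    (h k : ℂ → ℂ) : Prop where
  isOpen : IsOpen V
  convex : Convex ℝ V
  subset : V ⊆ U
  holo : DifferentiableOn ℂ h V
  h_ne : ∀ p ∈ V, h p ≠ 0
  smooth : ContDiffOn ℝ ∞ k V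
  k_ne : ∀ p ∈ V, k p ≠ 0
  mem_one_zero : ∀ p ∈ V, ∀ w : ℂ, w ∈ N₁ 0 p ↔ (h p * w).re = 0
  mem_one_one : ∀ p ∈ V, ∀ w : ℂ, w ∈ N₁ 1 p ↔ (h p * w).im = 0
  mem_two_zero : ∀ p ∈ V, ∀ w : ℂ, w ∈ N₂ 0 p ↔ (k p * w).re = 0
  mem_two_one : ∀ p ∈ V, ∀ w : ℂ, w ∈ N₂ 1 p ↔ (k p * w).im = 0

/-- A covector `η` is the real part of multiplication by `η 1 - i η i`. -/
lemma re_covector_mul (η : ℂ →L[ℝ] ℝ) (w : ℂ) : (((η 1 : ℂ) - I * (η I : ℂ)) * w).re = η w := by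
  have hw : w = w.re • (1 : ℂ) + w.im • I := by
    rw [real_smul, real_smul, mul_one, re_add_im]
  conv_rhs => rw [hw]
  rw [map_add, map_smul, map_smul]
  simp; ring

lemma exists_ne_zero_mem_of_foliation {U : Set ℂ} {D : DirectionField} (hD : IsFoliation U D)
    {p : ℂ} (hp : p ∈ U) : ∃ v ∈ D p, v ≠ 0 := by
  obtain ⟨V, -, hpV, -, η, -, hη⟩ := hD p hp
  obtain ⟨h0, hker⟩ := hη p hpV
  set k : ℂ := (η p 1 : ℂ) - I * (η p I : ℂ) with hk
  have hk0 : k ≠ 0 := by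
    intro h
    apply h0
    ext w
    rw [← re_covector_mul, ← hk, h]; simp
  refine ⟨I / k, (hker _).2 ?_, div_ne_zero I_ne_zero hk0⟩
  rw [← re_covector_mul, ← hk, mul_div_cancel₀ _ hk0, I_re]

lemma eq_real_smul_of_im_mul_eq_zero {k v w : ℂ} (hk : k ≠ 0) (hv : v ≠ 0) (h1 : (k * v).im = 0)
    (h2 : (k * w).im = 0) : w = ((k * w).re / (k * v).re) • v := by
  have e1 : k * v = ((k * v).re : ℂ) := by apply Complex.ext <;> simp [h1]
  have e2 : k * w = ((k * w).re : ℂ) := by apply Complex.ext <;> simp [h2]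
  have hne : ((k * v).re : ℂ) ≠ 0 := by rw [← e1]; exact mul_ne_zero hk hv
  rw [real_smul, ofReal_div]
  apply mul_left_cancel₀ hk
  rw [mul_left_comm, e2, e1, ofReal_re, ofReal_re, div_mul_cancel₀ _ hne]

theorem exists_adapted_chart {U : Set ℂ} {N₁ N₂ : Fin 2 → DirectionField}
    (hN₂ : IsOrthogonalNet U N₂) (hflat : IsConformallyFlat U N₁) {p : ℂ} (hp : p ∈ U) :
    ∃ V h k, p ∈ V ∧ IsAdaptedChart U N₁ N₂ V h k := by
  obtain ⟨V₁, hV₁, hp₁, hs₁, g, hg, hgN⟩ := hflat p hp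
  obtain ⟨V₂, hV₂, hp₂, hs₂, η, hη, hηN⟩ := hN₂.foliation 0 p hp
  obtain ⟨r, hr, hball⟩ := Metric.isOpen_iff.1 (hV₁.inter hV₂) p ⟨hp₁, hp₂⟩
  have hk0 : ∀ q ∈ Metric.ball p r, (η q 1 : ℂ) - I * (η q I : ℂ) ≠ 0 := by
    intro q hq h
    apply (hηN q (hball hq).2).1
    ext w
    rw [← re_covector_mul, h]; simp
  refine ⟨Metric.ball p r, deriv g, fun q => (η q 1 : ℂ) - I * (η q I : ℂ),
    Metric.mem_ball_self hr, Metric.isOpen_ball, convex_ball p r, fun q hq => hs₁ (hball hq).1,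
    (hg.deriv hV₁).mono fun q hq => (hball hq).1, fun q hq => (hgN q (hball hq).1).1, ?_, hk0,
    fun q hq => (hgN q (hball hq).1).2.1, fun q hq => (hgN q (hball hq).1).2.2,
    fun q hq w => ?_, fun q hq w => ?_⟩
  · have hη' : ContDiffOn ℝ ∞ η (Metric.ball p r) := hη.mono fun q hq => (hball hq).2
    have h1 : ∀ c : ℂ, ContDiffOn ℝ ∞ (fun q => (η q c : ℂ)) (Metric.ball p r) := fun c =>
      ofRealCLM.contDiff.comp_contDiffOn (hη'.clm_apply contDiffOn_const)
    exact (h1 1).sub (contDiffOn_const.mul (h1 I))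
  · rw [re_covector_mul]; exact (hηN q (hball hq).2).2 w
  · set k : ℂ := (η q 1 : ℂ) - I * (η q I : ℂ) with hk
    have hqU : q ∈ U := hs₁ (hball hq).1
    have hk' : k ≠ 0 := hk0 q hq
    have hmem : I / k ∈ N₂ 0 q := by
      rw [(hηN q (hball hq).2).2, ← re_covector_mul, ← hk, mul_div_cancel₀ _ hk', I_re]
    have hsub : ∀ v ∈ N₂ 1 q, (k * v).im = 0 := by
      intro v hv
      have h1 : inner ℝ (I / k) v = 0 :=
        (Submodule.isOrtho_iff_inner_eq.1 (hN₂.orthogonal q hqU)) _ hmem v hv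
      have h2 : k * v = (normSq k : ℂ) * (I * (v * (starRingEnd ℂ) (I / k))) := by
        rw [map_div₀, conj_I, normSq_eq_conj_mul_self]
        have : (starRingEnd ℂ) k ≠ 0 := (map_ne_zero _).2 hk'
        field_simp
        rw [I_sq]; ring
      rw [Complex.inner] at h1
      rw [h2, im_ofReal_mul, I_mul_im]
      rw [h1, mul_zero]
    refine ⟨hsub w, fun hw => ?_⟩
    obtain ⟨v, hv, hv0⟩ := exists_ne_zero_mem_of_foliation (hN₂.foliation 1) hqU
    rw [eq_real_smul_of_im_mul_eq_zero hk' hv0 (hsub v hv) hw]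
    exact Submodule.smul_mem _ _ hv

/-- With `k / h = r e^{-iφ}` this is `e^{2iφ}`, where `φ` is the angle between the two nets. Its
imaginary part is non-zero exactly where the two nets are transverse. -/
noncomputable def frameTwist (h k : ℂ → ℂ) (p : ℂ) : ℂ :=
  (starRingEnd ℂ) (k p / h p) / (k p / h p)

/-- The coefficient of `a` in the equation `∂ᵤa + Xa = ∂ᵥb + Yb` of Abelian relations. -/
noncomputable def coeffU (h k : ℂ → ℂ) (p : ℂ) : ℝ :=
  (frameDeriv h 1 (fun q => (frameTwist h k q).im) p
    - frameDeriv h I (fun q => (frameTwist h k q).re) p) / (frameTwist h k p).im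

/-- The coefficient of `b` in the equation `∂ᵤa + Xa = ∂ᵥb + Yb` of Abelian relations. -/
noncomputable def coeffV (h k : ℂ → ℂ) (p : ℂ) : ℝ :=
  (frameDeriv h 1 (fun q => (frameTwist h k q).re) p
    + frameDeriv h I (fun q => (frameTwist h k q).im) p) / (frameTwist h k p).im

namespace IsAdaptedChart

variable {U : Set ℂ} {N₁ N₂ : Fin 2 → DirectionField} {V : Set ℂ} {h k : ℂ → ℂ}

lemma div_ne (H : IsAdaptedChart U N₁ N₂ V h k) {p : ℂ} (hp : p ∈ V) : k p / h p ≠ 0 :=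
  div_ne_zero (H.k_ne p hp) (H.h_ne p hp)

lemma re_div_ne (H : IsAdaptedChart U N₁ N₂ V h k) (hweb : IsWeb U (webOfNets N₁ N₂)) {p : ℂ}
    (hp : p ∈ V) : (k p / h p).re ≠ 0 := by
  intro h0
  have him : (k p / h p).im ≠ 0 := fun h1 => H.div_ne hp (Complex.ext h0 h1)
  apply hweb.transverse p (H.subset hp) 2 1 (by decide)
  ext w
  change w ∈ N₂ 0 p ↔ w ∈ N₁ 1 p
  rw [H.mem_two_zero p hp, H.mem_one_one p hp]
  have : k p * w = (k p / h p) * (h p * w) := by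
    rw [← mul_assoc, div_mul_cancel₀ _ (H.h_ne p hp)]
  rw [this, mul_re, h0]
  simp [him]

lemma im_div_ne (H : IsAdaptedChart U N₁ N₂ V h k) (hweb : IsWeb U (webOfNets N₁ N₂)) {p : ℂ}
    (hp : p ∈ V) : (k p / h p).im ≠ 0 := by
  intro h0
  have hre : (k p / h p).re ≠ 0 := fun h1 => H.div_ne hp (Complex.ext h1 h0)
  apply hweb.transverse p (H.subset hp) 2 0 (by decide)
  ext w
  change w ∈ N₂ 0 p ↔ w ∈ N₁ 0 p
  rw [H.mem_two_zero p hp, H.mem_one_zero p hp]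
  have : k p * w = (k p / h p) * (h p * w) := by
    rw [← mul_assoc, div_mul_cancel₀ _ (H.h_ne p hp)]
  rw [this, mul_re, h0]
  simp [hre]

lemma frameTwist_re {p : ℂ} : (frameTwist h k p).re
    = ((k p / h p).re ^ 2 - (k p / h p).im ^ 2) / ((k p / h p).re ^ 2 + (k p / h p).im ^ 2) := by
  simp only [frameTwist, div_re ((starRingEnd ℂ) _), conj_re, conj_im, normSq_apply]
  ring

lemma frameTwist_im {p : ℂ} : (frameTwist h k p).im
    = -(2 * (k p / h p).re * (k p / h p).im) / ((k p / h p).re ^ 2 + (k p / h p).im ^ 2) := by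
  simp only [frameTwist, div_im ((starRingEnd ℂ) _), conj_re, conj_im, normSq_apply]
  ring

lemma normSq_div_ne (H : IsAdaptedChart U N₁ N₂ V h k) {p : ℂ} (hp : p ∈ V) :
    (k p / h p).re ^ 2 + (k p / h p).im ^ 2 ≠ 0 := by
  have := normSq_eq_zero.not.2 (H.div_ne hp)
  rwa [normSq_apply, ← sq, ← sq] at this

lemma frameTwist_im_ne (H : IsAdaptedChart U N₁ N₂ V h k) (hweb : IsWeb U (webOfNets N₁ N₂))
    {p : ℂ} (hp : p ∈ V) : (frameTwist h k p).im ≠ 0 := by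
  rw [frameTwist_im]
  exact div_ne_zero (neg_ne_zero.2 (mul_ne_zero (mul_ne_zero two_ne_zero (H.re_div_ne hweb hp))
    (H.im_div_ne hweb hp))) (H.normSq_div_ne hp)

lemma contDiffOn_frameTwist (H : IsAdaptedChart U N₁ N₂ V h k) :
    ContDiffOn ℝ ∞ (frameTwist h k) V := by
  have h1 : ContDiffOn ℝ ∞ (fun p => k p / h p) V := by
    have := H.smooth.mul (contDiffOn_const_div H.isOpen H.holo H.h_ne 1)
    simpa only [mul_one_div] using this
  have h2 : ContDiffOn ℝ ∞ (fun p => (starRingEnd ℂ) (k p / h p)) V :=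
    conjCLE.contDiff.comp_contDiffOn h1
  have h3 : ContDiffOn ℝ ∞ (fun p => (k p / h p)⁻¹) V := h1.inv fun p hp => H.div_ne hp
  have h4 := h2.mul h3
  exact h4.congr fun p _ => div_eq_mul_inv _ _

lemma contDiffOn_re (H : IsAdaptedChart U N₁ N₂ V h k) :
    ContDiffOn ℝ ∞ (fun p => (frameTwist h k p).re) V :=
  reCLM.contDiff.comp_contDiffOn H.contDiffOn_frameTwist

lemma contDiffOn_im (H : IsAdaptedChart U N₁ N₂ V h k) :
    ContDiffOn ℝ ∞ (fun p => (frameTwist h k p).im) V :=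
  imCLM.contDiff.comp_contDiffOn H.contDiffOn_frameTwist

lemma contDiffOn_frameDeriv (H : IsAdaptedChart U N₁ N₂ V h k) {f : ℂ → ℝ}
    (hf : ContDiffOn ℝ ∞ f V) (c : ℂ) : ContDiffOn ℝ ∞ (frameDeriv h c f) V :=
  _root_.contDiffOn_frameDeriv H.isOpen H.holo H.h_ne hf c

lemma contDiffOn_coeffU (H : IsAdaptedChart U N₁ N₂ V h k) (hweb : IsWeb U (webOfNets N₁ N₂)) :
    ContDiffOn ℝ ∞ (coeffU h k) V :=
  ((H.contDiffOn_frameDeriv H.contDiffOn_im 1).sub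
    (H.contDiffOn_frameDeriv H.contDiffOn_re I)).div H.contDiffOn_im
    fun _ hp => H.frameTwist_im_ne hweb hp

lemma contDiffOn_coeffV (H : IsAdaptedChart U N₁ N₂ V h k) (hweb : IsWeb U (webOfNets N₁ N₂)) :
    ContDiffOn ℝ ∞ (coeffV h k) V :=
  ((H.contDiffOn_frameDeriv H.contDiffOn_re 1).add
    (H.contDiffOn_frameDeriv H.contDiffOn_im I)).div H.contDiffOn_im
    fun _ hp => H.frameTwist_im_ne hweb hp

end IsAdaptedChart

/-- The component `θ i` of an Abelian relation evaluated on the field `c / h`: for `i = 0`, `c = 1`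
this is `a` in `θ 0 = a du`, for `i = 1`, `c = I` it is `b` in `θ 1 = b dv`. -/
noncomputable def frameComp (h : ℂ → ℂ) (i : Fin 4) (c : ℂ) (θ : Fin 4 → ℂ → ℂ →L[ℝ] ℝ)
    (p : ℂ) : ℝ :=
  θ i p (c / h p)

/-- The common value `∂ᵤa + Xa = ∂ᵥb + Yb`. Together with `a` and `b` it is the full jet of an
Abelian relation. -/
noncomputable def frameJet (h k : ℂ → ℂ) (θ : Fin 4 → ℂ → ℂ →L[ℝ] ℝ) (p : ℂ) : ℝ :=
  frameDeriv h 1 (frameComp h 0 1 θ) p + coeffU h k p * frameComp h 0 1 θ p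

namespace IsAdaptedChart

variable {U : Set ℂ} {N₁ N₂ : Fin 2 → DirectionField} {V : Set ℂ} {h k : ℂ → ℂ}
  {θ : Fin 4 → ℂ → ℂ →L[ℝ] ℝ} {hU : IsOpen U}

lemma contDiffOn_frameComp (H : IsAdaptedChart U N₁ N₂ V h k)
    (hθ : θ ∈ abelianRelations U (webOfNets N₁ N₂) hU) (i : Fin 4) (c : ℂ) :
    ContDiffOn ℝ ∞ (frameComp h i c θ) V :=
  contDiffOn_frame_apply H.isOpen H.holo H.h_ne ((hθ.1 i).mono H.subset) c

/-- `θ 0 = a du`. -/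
lemma apply_zero (H : IsAdaptedChart U N₁ N₂ V h k)
    (hθ : θ ∈ abelianRelations U (webOfNets N₁ N₂) hU) {p : ℂ} (hp : p ∈ V) (w : ℂ) :
    θ 0 p w = (h p * w).re * frameComp h 0 1 θ p :=
  apply_of_re_ker _ (H.h_ne p hp)
    (fun v hv => hθ.2.2.1 0 p (H.subset hp) v ((H.mem_one_zero p hp v).2 hv)) w

/-- `θ 1 = b dv`. -/
lemma apply_one (H : IsAdaptedChart U N₁ N₂ V h k)
    (hθ : θ ∈ abelianRelations U (webOfNets N₁ N₂) hU) {p : ℂ} (hp : p ∈ V) (w : ℂ) :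
    θ 1 p w = (h p * w).im * frameComp h 1 I θ p :=
  apply_of_im_ker _ (H.h_ne p hp)
    (fun v hv => hθ.2.2.1 1 p (H.subset hp) v ((H.mem_one_one p hp v).2 hv)) w

lemma apply_two (H : IsAdaptedChart U N₁ N₂ V h k)
    (hθ : θ ∈ abelianRelations U (webOfNets N₁ N₂) hU) {p : ℂ} (hp : p ∈ V) (w : ℂ) :
    θ 2 p w = (k p * w).re * θ 2 p (1 / k p) :=
  apply_of_re_ker _ (H.k_ne p hp)
    (fun v hv => hθ.2.2.1 2 p (H.subset hp) v ((H.mem_two_zero p hp v).2 hv)) w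

lemma apply_three (H : IsAdaptedChart U N₁ N₂ V h k)
    (hθ : θ ∈ abelianRelations U (webOfNets N₁ N₂) hU) {p : ℂ} (hp : p ∈ V) (w : ℂ) :
    θ 3 p w = (k p * w).im * θ 3 p (I / k p) :=
  apply_of_im_ker _ (H.k_ne p hp)
    (fun v hv => hθ.2.2.1 3 p (H.subset hp) v ((H.mem_two_one p hp v).2 hv)) w

/-- The components of the relation along the second net, expressed by those along the first:
the pair `(θ 2, θ 3)` is the orthogonal decomposition of `-(a du + b dv)`. -/
lemma comp_two_three (H : IsAdaptedChart U N₁ N₂ V h k)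
    (hθ : θ ∈ abelianRelations U (webOfNets N₁ N₂) hU) {p : ℂ} (hp : p ∈ V) :
    θ 2 p (1 / k p) * ((k p / h p).re ^ 2 + (k p / h p).im ^ 2)
        = -(k p / h p).re * frameComp h 0 1 θ p + (k p / h p).im * frameComp h 1 I θ p ∧
      θ 3 p (I / k p) * ((k p / h p).re ^ 2 + (k p / h p).im ^ 2)
        = -(k p / h p).im * frameComp h 0 1 θ p - (k p / h p).re * frameComp h 1 I θ p := by
  have hsum := hθ.2.2.2.2 p (H.subset hp)
  have hh := H.h_ne p hp
  have e : ∀ w, θ 0 p w + θ 1 p w + θ 2 p w + θ 3 p w = 0 := by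
    intro w
    have := DFunLike.congr_fun hsum w
    simpa [Fin.sum_univ_four] using this
  have e1 := e (1 / h p)
  have e2 := e (I / h p)
  rw [H.apply_zero hθ hp, H.apply_one hθ hp, H.apply_two hθ hp, H.apply_three hθ hp] at e1 e2
  have f1 : h p * (1 / h p) = 1 := by field_simp
  have f2 : h p * (I / h p) = I := by field_simp
  have f3 : k p * (1 / h p) = k p / h p := by ring
  have f4 : k p * (I / h p) = I * (k p / h p) := by ring
  rw [f1, f3] at e1
  rw [f2, f4] at e2
  simp only [one_re, one_im, I_re, I_im, I_mul_re, I_mul_im] at e1 e2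
  constructor
  · linear_combination (k p / h p).re * e1 - (k p / h p).im * e2
  · linear_combination (k p / h p).im * e1 + (k p / h p).re * e2

lemma two_sub_three (H : IsAdaptedChart U N₁ N₂ V h k)
    (hθ : θ ∈ abelianRelations U (webOfNets N₁ N₂) hU) {p : ℂ} (hp : p ∈ V) :
    (θ 2 p - θ 3 p) (1 / h p) = -(frameComp h 0 1 θ p * (frameTwist h k p).re
        + frameComp h 1 I θ p * (frameTwist h k p).im) ∧
      (θ 2 p - θ 3 p) (I / h p) = -(frameComp h 0 1 θ p * (frameTwist h k p).im
        - frameComp h 1 I θ p * (frameTwist h k p).re) := by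
  obtain ⟨e1, e2⟩ := H.comp_two_three hθ hp
  have hn := H.normSq_div_ne hp
  rw [← eq_div_iff hn] at e1 e2
  have f3 : k p * (1 / h p) = k p / h p := by ring
  have f4 : k p * (I / h p) = I * (k p / h p) := by ring
  rw [sub_apply, sub_apply, H.apply_two hθ hp (1 / h p), H.apply_two hθ hp (I / h p),
    H.apply_three hθ hp (1 / h p), H.apply_three hθ hp (I / h p), e1, e2, f3, f4, frameTwist_re,
    frameTwist_im, I_mul_re, I_mul_im]
  constructor <;> field_simp <;> ring

lemma frameDeriv_comp_zero (H : IsAdaptedChart U N₁ N₂ V h k)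
    (hθ : θ ∈ abelianRelations U (webOfNets N₁ N₂) hU) {p : ℂ} (hp : p ∈ V) :
    frameDeriv h I (frameComp h 0 1 θ) p = 0 := by
  have h1 := frameDeriv_closed H.isOpen H.holo H.h_ne hp
    (differentiableAt_of_contDiffOn H.isOpen ((hθ.1 0).mono H.subset) hp)
    (hθ.2.2.2.1 0 p (H.subset hp)) I 1
  have h2 : EqOn (fun q => θ 0 q (I / h q)) (fun _ => 0) V := by
    intro q hq
    have : h q * (I / h q) = I := mul_div_cancel₀ _ (H.h_ne q hq)
    simp only
    rw [H.apply_zero hθ hq, this]; simp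
  rw [frameDeriv_congr H.isOpen h2 1 hp, frameDeriv_const] at h1
  exact h1

lemma frameDeriv_comp_one (H : IsAdaptedChart U N₁ N₂ V h k)
    (hθ : θ ∈ abelianRelations U (webOfNets N₁ N₂) hU) {p : ℂ} (hp : p ∈ V) :
    frameDeriv h 1 (frameComp h 1 I θ) p = 0 := by
  have h1 := frameDeriv_closed H.isOpen H.holo H.h_ne hp
    (differentiableAt_of_contDiffOn H.isOpen ((hθ.1 1).mono H.subset) hp)
    (hθ.2.2.2.1 1 p (H.subset hp)) 1 I
  have h2 : EqOn (fun q => θ 1 q (1 / h q)) (fun _ => 0) V := by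
    intro q hq
    have : h q * (1 / h q) = 1 := mul_div_cancel₀ _ (H.h_ne q hq)
    simp only
    rw [H.apply_one hθ hq, this]; simp
  rw [frameDeriv_congr H.isOpen h2 I hp, frameDeriv_const] at h1
  exact h1

/-- The equation `∂ᵤa + Xa = ∂ᵥb + Yb`: it says that `θ 2 - θ 3` is closed. -/
lemma frameJet_eq (H : IsAdaptedChart U N₁ N₂ V h k) (hweb : IsWeb U (webOfNets N₁ N₂))
    (hθ : θ ∈ abelianRelations U (webOfNets N₁ N₂) hU) {p : ℂ} (hp : p ∈ V) :
    frameJet h k θ p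
      = frameDeriv h I (frameComp h 1 I θ) p + coeffV h k p * frameComp h 1 I θ p := by
  have d2 := differentiableAt_of_contDiffOn H.isOpen ((hθ.1 2).mono H.subset) hp
  have d3 := differentiableAt_of_contDiffOn H.isOpen ((hθ.1 3).mono H.subset) hp
  have h1 := frameDeriv_closed (θ := fun q => θ 2 q - θ 3 q) H.isOpen H.holo H.h_ne hp
    (d2.sub d3) (by
      intro v w
      rw [fderiv_fun_sub d2 d3]
      simp [hθ.2.2.2.1 2 p (H.subset hp) v w, hθ.2.2.2.1 3 p (H.subset hp) v w]) I 1
  have e1 : EqOn (fun q => (θ 2 q - θ 3 q) (1 / h q))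
      (fun q => (-1) * (frameComp h 0 1 θ q * (frameTwist h k q).re
        + frameComp h 1 I θ q * (frameTwist h k q).im)) V := by
    intro q hq
    simp only [(H.two_sub_three hθ hq).1]; ring
  have e2 : EqOn (fun q => (θ 2 q - θ 3 q) (I / h q))
      (fun q => (-1) * (frameComp h 0 1 θ q * (frameTwist h k q).im
        - frameComp h 1 I θ q * (frameTwist h k q).re)) V := by
    intro q hq
    simp only [(H.two_sub_three hθ hq).2]; ring
  have da := differentiableAt_of_contDiffOn H.isOpen (H.contDiffOn_frameComp hθ 0 1) hp
  have db := differentiableAt_of_contDiffOn H.isOpen (H.contDiffOn_frameComp hθ 1 I) hp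
  have dC := differentiableAt_of_contDiffOn H.isOpen H.contDiffOn_re hp
  have dS := differentiableAt_of_contDiffOn H.isOpen H.contDiffOn_im hp
  rw [frameDeriv_congr H.isOpen e1 I hp, frameDeriv_congr H.isOpen e2 1 hp,
    frameDeriv_const_mul ((da.fun_mul dC).fun_add (db.fun_mul dS)),
    frameDeriv_const_mul ((da.fun_mul dS).fun_sub (db.fun_mul dC)),
    frameDeriv_add (da.fun_mul dC) (db.fun_mul dS), frameDeriv_sub (da.fun_mul dS) (db.fun_mul dC),
    frameDeriv_mul da dC, frameDeriv_mul db dS, frameDeriv_mul da dS, frameDeriv_mul db dC,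
    H.frameDeriv_comp_zero hθ hp, H.frameDeriv_comp_one hθ hp] at h1
  have hS := H.frameTwist_im_ne hweb hp
  rw [frameJet, coeffU, coeffV]
  field_simp
  linear_combination h1

lemma contDiffOn_frameJet (H : IsAdaptedChart U N₁ N₂ V h k) (hweb : IsWeb U (webOfNets N₁ N₂))
    (hθ : θ ∈ abelianRelations U (webOfNets N₁ N₂) hU) :
    ContDiffOn ℝ ∞ (frameJet h k θ) V :=
  (H.contDiffOn_frameDeriv (H.contDiffOn_frameComp hθ 0 1) 1).add
    ((H.contDiffOn_coeffU hweb).mul (H.contDiffOn_frameComp hθ 0 1))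

lemma frameDeriv_one_jet (H : IsAdaptedChart U N₁ N₂ V h k) (hweb : IsWeb U (webOfNets N₁ N₂))
    (hθ : θ ∈ abelianRelations U (webOfNets N₁ N₂) hU) {p : ℂ} (hp : p ∈ V) :
    frameDeriv h 1 (frameJet h k θ) p = frameDeriv h 1 (coeffV h k) p * frameComp h 1 I θ p := by
  have hb := H.contDiffOn_frameComp hθ 1 I
  have db := differentiableAt_of_contDiffOn H.isOpen hb hp
  have dY := differentiableAt_of_contDiffOn H.isOpen (H.contDiffOn_coeffV hweb) hp
  have dbI := differentiableAt_of_contDiffOn H.isOpen (H.contDiffOn_frameDeriv hb I) hp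
  rw [frameDeriv_congr H.isOpen (fun q hq => H.frameJet_eq hweb hθ hq) 1 hp,
    frameDeriv_add dbI (dY.fun_mul db), frameDeriv_mul dY db,
    frameDeriv_comm H.isOpen H.holo H.h_ne hb hp,
    frameDeriv_congr H.isOpen (g := fun _ => 0) (fun q hq => H.frameDeriv_comp_one hθ hq) I hp,
    frameDeriv_const, H.frameDeriv_comp_one hθ hp]
  ring

lemma frameDeriv_I_jet (H : IsAdaptedChart U N₁ N₂ V h k) (hweb : IsWeb U (webOfNets N₁ N₂))
    (hθ : θ ∈ abelianRelations U (webOfNets N₁ N₂) hU) {p : ℂ} (hp : p ∈ V) :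
    frameDeriv h I (frameJet h k θ) p = frameDeriv h I (coeffU h k) p * frameComp h 0 1 θ p := by
  have ha := H.contDiffOn_frameComp hθ 0 1
  have da := differentiableAt_of_contDiffOn H.isOpen ha hp
  have dX := differentiableAt_of_contDiffOn H.isOpen (H.contDiffOn_coeffU hweb) hp
  have daI := differentiableAt_of_contDiffOn H.isOpen (H.contDiffOn_frameDeriv ha 1) hp
  have : frameJet h k θ = fun q => frameDeriv h 1 (frameComp h 0 1 θ) q
      + coeffU h k q * frameComp h 0 1 θ q := rfl
  rw [this, frameDeriv_add daI (dX.fun_mul da), frameDeriv_mul dX da,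
    frameDeriv_comm H.isOpen H.holo H.h_ne ha hp,
    frameDeriv_congr H.isOpen (g := fun _ => 0) (fun q hq => H.frameDeriv_comp_zero hθ hq) 1 hp,
    frameDeriv_const, H.frameDeriv_comp_zero hθ hp]
  ring

lemma frameDeriv_one_comp_zero :
    frameDeriv h 1 (frameComp h 0 1 θ) = fun p =>
      frameJet h k θ p - coeffU h k p * frameComp h 0 1 θ p := by
  funext p; rw [frameJet]; ring

lemma frameDeriv_I_comp_one (H : IsAdaptedChart U N₁ N₂ V h k)
    (hweb : IsWeb U (webOfNets N₁ N₂))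
    (hθ : θ ∈ abelianRelations U (webOfNets N₁ N₂) hU) {p : ℂ} (hp : p ∈ V) :
    frameDeriv h I (frameComp h 1 I θ) p
      = frameJet h k θ p - coeffV h k p * frameComp h 1 I θ p := by
  rw [H.frameJet_eq hweb hθ hp]; ring

/-- On a chart an Abelian relation is determined by its jet `(a, b, y)` at one point. -/
lemma eqOn_zero_of_jet (H : IsAdaptedChart U N₁ N₂ V h k) (hweb : IsWeb U (webOfNets N₁ N₂))
    (hθ : θ ∈ abelianRelations U (webOfNets N₁ N₂) hU) {p : ℂ} (hp : p ∈ V)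
    (ha : frameComp h 0 1 θ p = 0) (hb : frameComp h 1 I θ p = 0) (hy : frameJet h k θ p = 0) :
    ∀ q ∈ V, ∀ i, θ i q = 0 := by
  have cX := (H.contDiffOn_coeffU hweb).continuousOn
  have cY := (H.contDiffOn_coeffV hweb).continuousOn
  have cXv := (H.contDiffOn_frameDeriv (H.contDiffOn_coeffU hweb) I).continuousOn
  have cYu := (H.contDiffOn_frameDeriv (H.contDiffOn_coeffV hweb) 1).continuousOn
  have key := eqOn_zero_of_linear_system (ι := Fin 3) (h := h) H.convex H.holo.continuousOn H.h_ne
    (f := ![frameComp h 0 1 θ, frameComp h 1 I θ, frameJet h k θ])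
    (A := ![![fun p => -coeffU h k p, fun _ => 0, fun _ => 1],
      ![fun _ => 0, fun _ => 0, fun _ => 0],
      ![fun _ => 0, frameDeriv h 1 (coeffV h k), fun _ => 0]])
    (B := ![![fun _ => 0, fun _ => 0, fun _ => 0],
      ![fun _ => 0, fun p => -coeffV h k p, fun _ => 1],
      ![frameDeriv h I (coeffU h k), fun _ => 0, fun _ => 0]])
    (by
      intro i q hq
      fin_cases i
      · exact differentiableAt_of_contDiffOn H.isOpen (H.contDiffOn_frameComp hθ 0 1) hq
      · exact differentiableAt_of_contDiffOn H.isOpen (H.contDiffOn_frameComp hθ 1 I) hq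
      · exact differentiableAt_of_contDiffOn H.isOpen (H.contDiffOn_frameJet hweb hθ) hq)
    (by
      intro i j
      fin_cases i <;> fin_cases j <;>
        first | exact continuousOn_const | exact cX.neg | exact cYu)
    (by
      intro i j
      fin_cases i <;> fin_cases j <;>
        first | exact continuousOn_const | exact cY.neg | exact cXv)
    (by
      intro i q hq
      fin_cases i
      · simp [Fin.sum_univ_three, frameDeriv_one_comp_zero (k := k)]; ring
      · simp [Fin.sum_univ_three, H.frameDeriv_comp_one hθ hq]
      · simp [Fin.sum_univ_three, H.frameDeriv_one_jet hweb hθ hq])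
    (by
      intro i q hq
      fin_cases i
      · simp [Fin.sum_univ_three, H.frameDeriv_comp_zero hθ hq]
      · simp [Fin.sum_univ_three, H.frameDeriv_I_comp_one hweb hθ hq]; ring
      · simp [Fin.sum_univ_three, H.frameDeriv_I_jet hweb hθ hq])
    hp (by intro i; fin_cases i <;> simp [ha, hb, hy])
  intro q hq
  have hn := H.normSq_div_ne hq
  have ha' : frameComp h 0 1 θ q = 0 := key 0 q hq
  have hb' : frameComp h 1 I θ q = 0 := key 1 q hq
  obtain ⟨e2, e3⟩ := H.comp_two_three hθ hq
  simp only [ha', hb', mul_zero, add_zero, sub_zero, mul_eq_zero, hn, or_false] at e2 e3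
  intro i
  ext w
  fin_cases i
  · simp [H.apply_zero hθ hq w, ha']
  · simp [H.apply_one hθ hq w, hb']
  · change θ 2 q w = 0
    rw [H.apply_two hθ hq w, e2, mul_zero]
  · change θ 3 q w = 0
    rw [H.apply_three hθ hq w, e3, mul_zero]

end IsAdaptedChart

/-! ### Jets of Abelian relations -/

lemma frameDeriv_eq_zero_of_eventuallyEq {h : ℂ → ℂ} {f : ℂ → ℝ} {p : ℂ}
    (hf : ∀ᶠ q in 𝓝 p, f q = 0) (c : ℂ) : frameDeriv h c f p = 0 := by
  have : f =ᶠ[𝓝 p] fun _ => 0 := hf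
  simp [frameDeriv, this.fderiv_eq]

/-- An Abelian relation on a connected domain is determined by its jet `(a, b, y)` at one point. -/
theorem IsAdaptedChart.eq_zero_of_jet {U : Set ℂ} {hU : IsOpen U} (hconn : IsConnected U)
    {N₁ N₂ : Fin 2 → DirectionField} (hN₂ : IsOrthogonalNet U N₂)
    (hweb : IsWeb U (webOfNets N₁ N₂)) (hflat : IsConformallyFlat U N₁)
    {θ : Fin 4 → ℂ → ℂ →L[ℝ] ℝ} (hθ : θ ∈ abelianRelations U (webOfNets N₁ N₂) hU)
    {V : Set ℂ} {h k : ℂ → ℂ} (H : IsAdaptedChart U N₁ N₂ V h k) {p : ℂ} (hp : p ∈ V)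
    (ha : frameComp h 0 1 θ p = 0) (hb : frameComp h 1 I θ p = 0) (hy : frameJet h k θ p = 0) :
    θ = 0 := by
  have hV := H.eqOn_zero_of_jet hweb hθ hp ha hb hy
  have key := forall_mem_of_local_spread (P := fun q => ∀ i, θ i q = 0) hconn.isPreconnected
    (by
      intro q hq
      obtain ⟨V', h', k', hqV, H'⟩ := exists_adapted_chart hN₂ hflat hq
      refine ⟨V', H'.isOpen, hqV, ?_⟩
      rintro ⟨z, hz, hzero⟩
      have hz0 : ∀ i c, ∀ᶠ w in 𝓝 z, frameComp h' i c θ w = 0 := fun i c =>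
        hzero.mono fun w hw => by simp [frameComp, hw i]
      refine H'.eqOn_zero_of_jet hweb hθ hz (hz0 0 1).self_of_nhds (hz0 1 I).self_of_nhds ?_
      rw [frameJet, frameDeriv_eq_zero_of_eventuallyEq (hz0 0 1), (hz0 0 1).self_of_nhds]
      simp)
    (H.subset hp) (eventually_of_mem (H.isOpen.mem_nhds hp) hV)
  funext i q
  by_cases hq : q ∈ U
  · exact key q hq i
  · exact hθ.2.1 i q hq

/-- The jets `(a, b, y)` of three Abelian relations at a point, as the columns of a matrix. -/
noncomputable def jetMatrix (h k : ℂ → ℂ) (θ : Fin 3 → Fin 4 → ℂ → ℂ →L[ℝ] ℝ) (p : ℂ) :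
    Matrix (Fin 3) (Fin 3) ℝ :=
  Matrix.of ![fun α => frameComp h 0 1 (θ α) p, fun α => frameComp h 1 I (θ α) p,
    fun α => frameJet h k (θ α) p]

section Triple

variable {U : Set ℂ} {hU : IsOpen U} {N₁ N₂ : Fin 2 → DirectionField} {V : Set ℂ} {h k : ℂ → ℂ}
  {θ : Fin 3 → Fin 4 → ℂ → ℂ →L[ℝ] ℝ}

lemma frameComp_combination (i : Fin 4) (c : ℂ) (r : Fin 3 → ℝ) (p : ℂ) :
    frameComp h i c (∑ α, r α • θ α) p = ∑ α, r α * frameComp h i c (θ α) p := by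
  simp [frameComp, Finset.sum_apply]

lemma combination_mem {W : Fin 4 → DirectionField} (hθ : ∀ α, θ α ∈ abelianRelations U W hU)
    (r : Fin 3 → ℝ) : ∑ α, r α • θ α ∈ abelianRelations U W hU :=
  Submodule.sum_mem _ fun α _ => Submodule.smul_mem _ _ (hθ α)

namespace IsAdaptedChart

lemma frameJet_combination (H : IsAdaptedChart U N₁ N₂ V h k)
    (hθ : ∀ α, θ α ∈ abelianRelations U (webOfNets N₁ N₂) hU) (r : Fin 3 → ℝ) {p : ℂ}
    (hp : p ∈ V) : frameJet h k (∑ α, r α • θ α) p = ∑ α, r α * frameJet h k (θ α) p := by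
  have hd : ∀ α, DifferentiableAt ℝ (frameComp h 0 1 (θ α)) p := fun α =>
    differentiableAt_of_contDiffOn H.isOpen (H.contDiffOn_frameComp (hθ α) 0 1) hp
  have e : frameComp h 0 1 (∑ α, r α • θ α) = fun q => ∑ α, r α * frameComp h 0 1 (θ α) q :=
    funext fun q => frameComp_combination 0 1 r q
  simp only [frameJet, e]
  rw [frameDeriv_sum _ fun α _ => (hd α).const_mul _, Finset.mul_sum, ← Finset.sum_add_distrib]
  refine Finset.sum_congr rfl fun α _ => ?_
  rw [frameDeriv_const_mul (hd α)]; ring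

/-- Maximality of the rank: every jet is the jet of an Abelian relation. -/
lemma isUnit_jetMatrix (hconn : IsConnected U) (hN₂ : IsOrthogonalNet U N₂)
    (hweb : IsWeb U (webOfNets N₁ N₂)) (hflat : IsConformallyFlat U N₁)
    (hθ : ∀ α, θ α ∈ abelianRelations U (webOfNets N₁ N₂) hU) (hli : LinearIndependent ℝ θ)
    (H : IsAdaptedChart U N₁ N₂ V h k) {p : ℂ} (hp : p ∈ V) : IsUnit (jetMatrix h k θ p) := by
  rw [← Matrix.mulVec_injective_iff_isUnit,
    ← Matrix.coe_mulVecLin, ← LinearMap.ker_eq_bot, LinearMap.ker_eq_bot']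
  intro r hr
  rw [Matrix.mulVecLin_apply] at hr
  have e : ∀ i, ∑ α, jetMatrix h k θ p i α * r α = 0 := fun i => congrFun hr i
  have hzero : ∑ α, r α • θ α = 0 := by
    refine H.eq_zero_of_jet hconn hN₂ hweb hflat (combination_mem hθ r) hp ?_ ?_ ?_
    · rw [frameComp_combination, ← e 0]
      exact Finset.sum_congr rfl fun α _ => mul_comm _ _
    · rw [frameComp_combination, ← e 1]
      exact Finset.sum_congr rfl fun α _ => mul_comm _ _
    · rw [H.frameJet_combination hθ r hp, ← e 2]
      exact Finset.sum_congr rfl fun α _ => mul_comm _ _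
  funext α
  exact Fintype.linearIndependent_iff.1 hli r hzero α

/-- The compatibility conditions of the system for `(a, b, y)`: it has a three-dimensional space of
solutions, hence the two ways of computing `∂ᵤ∂ᵥy` agree coefficientwise. The first equation says
that the angle between the nets is harmonic. -/
lemma compatibility (hconn : IsConnected U) (hN₂ : IsOrthogonalNet U N₂)
    (hweb : IsWeb U (webOfNets N₁ N₂)) (hflat : IsConformallyFlat U N₁)
    (hθ : ∀ α, θ α ∈ abelianRelations U (webOfNets N₁ N₂) hU) (hli : LinearIndependent ℝ θ)
    (H : IsAdaptedChart U N₁ N₂ V h k) :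
    (∀ p ∈ V, frameDeriv h 1 (coeffV h k) p = frameDeriv h I (coeffU h k) p) ∧
    (∀ p ∈ V, frameDeriv h 1 (frameDeriv h I (coeffU h k)) p
      = frameDeriv h I (coeffU h k) p * coeffU h k p) ∧
    (∀ p ∈ V, frameDeriv h I (frameDeriv h I (coeffU h k)) p
      = frameDeriv h I (coeffU h k) p * coeffV h k p) := by
  have hXv := H.contDiffOn_frameDeriv (H.contDiffOn_coeffU hweb) I
  have hYu := H.contDiffOn_frameDeriv (H.contDiffOn_coeffV hweb) 1
  have hrel : ∀ α, ∀ p ∈ V,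
      (frameDeriv h I (frameDeriv h 1 (coeffV h k)) p
          - frameDeriv h 1 (coeffV h k) p * coeffV h k p) * frameComp h 1 I (θ α) p
        + frameDeriv h 1 (coeffV h k) p * frameJet h k (θ α) p
      = (frameDeriv h 1 (frameDeriv h I (coeffU h k)) p
          - frameDeriv h I (coeffU h k) p * coeffU h k p) * frameComp h 0 1 (θ α) p
        + frameDeriv h I (coeffU h k) p * frameJet h k (θ α) p := by
    intro α p hp
    have hc := frameDeriv_comm H.isOpen H.holo H.h_ne
      (H.contDiffOn_frameJet hweb (hθ α)) hp I 1
    have da := differentiableAt_of_contDiffOn H.isOpen (H.contDiffOn_frameComp (hθ α) 0 1) hp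
    have db := differentiableAt_of_contDiffOn H.isOpen (H.contDiffOn_frameComp (hθ α) 1 I) hp
    rw [frameDeriv_congr H.isOpen (fun q hq => H.frameDeriv_one_jet hweb (hθ α) hq) I hp,
      frameDeriv_congr H.isOpen (fun q hq => H.frameDeriv_I_jet hweb (hθ α) hq) 1 hp,
      frameDeriv_mul (differentiableAt_of_contDiffOn H.isOpen hYu hp) db,
      frameDeriv_mul (differentiableAt_of_contDiffOn H.isOpen hXv hp) da,
      H.frameDeriv_I_comp_one hweb (hθ α) hp, frameDeriv_one_comp_zero (k := k)] at hc
    linear_combination hc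
  have hcoeff : ∀ p ∈ V,
      frameDeriv h 1 (frameDeriv h I (coeffU h k)) p
          - frameDeriv h I (coeffU h k) p * coeffU h k p = 0 ∧
      frameDeriv h I (frameDeriv h 1 (coeffV h k)) p
          - frameDeriv h 1 (coeffV h k) p * coeffV h k p = 0 ∧
      frameDeriv h 1 (coeffV h k) p - frameDeriv h I (coeffU h k) p = 0 := by
    intro p hp
    have hu := H.isUnit_jetMatrix hconn hN₂ hweb hflat hθ hli hp
    have hinj := Matrix.vecMul_injective_iff_isUnit.2 hu
    have hv : (![-(frameDeriv h 1 (frameDeriv h I (coeffU h k)) p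
          - frameDeriv h I (coeffU h k) p * coeffU h k p),
        frameDeriv h I (frameDeriv h 1 (coeffV h k)) p
          - frameDeriv h 1 (coeffV h k) p * coeffV h k p,
        frameDeriv h 1 (coeffV h k) p - frameDeriv h I (coeffU h k) p] : Fin 3 → ℝ) = 0 := by
      apply hinj
      funext α
      have := hrel α p hp
      simp only [Matrix.vecMul, dotProduct, Fin.sum_univ_three, jetMatrix, Matrix.of_apply,
        Matrix.cons_val_zero, Matrix.cons_val_one, Matrix.cons_val, Pi.zero_apply, zero_mul,
        add_zero]
      linear_combination this
    refine ⟨neg_eq_zero.1 (congrFun hv 0), congrFun hv 1, congrFun hv 2⟩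
  have h1 : ∀ p ∈ V, frameDeriv h 1 (coeffV h k) p = frameDeriv h I (coeffU h k) p :=
    fun p hp => sub_eq_zero.1 (hcoeff p hp).2.2
  refine ⟨h1, fun p hp => sub_eq_zero.1 (hcoeff p hp).1, fun p hp => ?_⟩
  have := sub_eq_zero.1 (hcoeff p hp).2.1
  rwa [frameDeriv_congr H.isOpen h1 I hp, h1 p hp] at this

end IsAdaptedChart

/-! ### Conformal flatness of the second net -/

lemma frameTwist_normSq (H : IsAdaptedChart U N₁ N₂ V h k) {p : ℂ} (hp : p ∈ V) :
    (frameTwist h k p).re ^ 2 + (frameTwist h k p).im ^ 2 = 1 := by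
  have := H.normSq_div_ne hp
  rw [IsAdaptedChart.frameTwist_re, IsAdaptedChart.frameTwist_im]
  field_simp; ring

lemma IsAdaptedChart.frameDeriv_normSq (H : IsAdaptedChart U N₁ N₂ V h k) {p : ℂ} (hp : p ∈ V)
    (c : ℂ) :
    (frameTwist h k p).re * frameDeriv h c (fun q => (frameTwist h k q).re) p
      + (frameTwist h k p).im * frameDeriv h c (fun q => (frameTwist h k q).im) p = 0 := by
  have dC := differentiableAt_of_contDiffOn H.isOpen H.contDiffOn_re hp
  have dS := differentiableAt_of_contDiffOn H.isOpen H.contDiffOn_im hp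
  have e : EqOn (fun q => (frameTwist h k q).re * (frameTwist h k q).re
      + (frameTwist h k q).im * (frameTwist h k q).im) (fun _ => 1) V := by
    intro q hq
    have := frameTwist_normSq H hq
    simp only; rw [← this]; ring
  have := frameDeriv_congr (h := h) H.isOpen e c hp
  rw [frameDeriv_const, frameDeriv_add (dC.fun_mul dC) (dS.fun_mul dS), frameDeriv_mul dC dC,
    frameDeriv_mul dS dS] at this
  linear_combination this / 2

lemma frameDeriv_div {f g : ℂ → ℝ} {p : ℂ} (hf : DifferentiableAt ℝ f p)
    (hg : DifferentiableAt ℝ g p) (h0 : g p ≠ 0) (c : ℂ) :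
    frameDeriv h c (fun q => f q / g q) p
      = (frameDeriv h c f p * g p - f p * frameDeriv h c g p) / g p ^ 2 := by
  have hi : HasFDerivAt (fun q => (g q)⁻¹) _ p :=
    (hasDerivAt_inv h0).comp_hasFDerivAt p hg.hasFDerivAt
  simp only [div_eq_mul_inv (f _)]
  rw [frameDeriv_mul hf hi.differentiableAt]
  simp only [frameDeriv, hi.fderiv, smul_apply, smul_eq_mul]
  field_simp
  ring

/-- If the angle between the nets is harmonic, then twice the angle is, modulo `π`, the argument of a
holomorphic function `Φ`. It takes values in the upper half plane, so that it has a logarithm. -/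
lemma IsAdaptedChart.exists_holomorphic_twist (H : IsAdaptedChart U N₁ N₂ V h k)
    (hweb : IsWeb U (webOfNets N₁ N₂))
    (hharm : ∀ p ∈ V, frameDeriv h 1 (coeffV h k) p = frameDeriv h I (coeffU h k) p) :
    ∃ Φ : ℂ → ℂ, DifferentiableOn ℂ Φ V ∧ ∀ p ∈ V, Φ p ∈ slitPlane ∧
      ∃ r : ℝ, 0 < r ∧ Φ p * (frameTwist h k p).im = r * frameTwist h k p := by
  obtain ⟨M, hM⟩ := exists_primitive_of_frame H.isOpen H.convex H.holo H.h_ne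
    (H.contDiffOn_coeffU hweb) (H.contDiffOn_coeffV hweb) (fun p hp => (hharm p hp).symm)
  have dE : ∀ p ∈ V, DifferentiableAt ℝ (fun q => Real.exp (M q)) p := fun p hp =>
    (hM p hp).1.exp
  have eE : ∀ c, ∀ p ∈ V, frameDeriv h c (fun q => Real.exp (M q)) p
      = Real.exp (M p) * frameDeriv h c M p := by
    intro c p hp
    simp only [frameDeriv]
    rw [fderiv_exp (hM p hp).1]; simp
  have ct : ContDiffOn ℝ ∞ (fun q => (frameTwist h k q).re / (frameTwist h k q).im) V :=
    H.contDiffOn_re.div H.contDiffOn_im fun _ hq => H.frameTwist_im_ne hweb hq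
  have dt : ∀ p ∈ V, DifferentiableAt ℝ
      (fun q => (frameTwist h k q).re / (frameTwist h k q).im) p := fun p hp =>
    differentiableAt_of_contDiffOn H.isOpen ct hp
  have et : ∀ c, ∀ p ∈ V, frameDeriv h c
      (fun q => (frameTwist h k q).re / (frameTwist h k q).im) p = _ := fun c p hp =>
    frameDeriv_div (differentiableAt_of_contDiffOn H.isOpen H.contDiffOn_re hp)
      (differentiableAt_of_contDiffOn H.isOpen H.contDiffOn_im hp) (H.frameTwist_im_ne hweb hp) c
  refine ⟨fun p => ((Real.exp (M p) * ((frameTwist h k p).re / (frameTwist h k p).im) : ℝ) : ℂ)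
      + (Real.exp (M p) : ℝ) * I,
    differentiableOn_of_frame_cauchyRiemann H.h_ne (fun p hp => (dE p hp).fun_mul (dt p hp)) dE
      ?_ ?_, ?_⟩
  · intro p hp
    rw [frameDeriv_mul (dE p hp) (dt p hp), eE 1 p hp, eE I p hp, (hM p hp).2.1, (hM p hp).2.2,
      et 1 p hp, coeffU, coeffV]
    have hS := H.frameTwist_im_ne hweb hp
    have n1 := H.frameDeriv_normSq hp 1
    have nI := H.frameDeriv_normSq hp I
    field_simp
    linear_combination (-1 : ℝ) * nI
  · intro p hp
    rw [frameDeriv_mul (dE p hp) (dt p hp), eE 1 p hp, eE I p hp, (hM p hp).2.1, (hM p hp).2.2,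
      et I p hp, coeffU, coeffV]
    have hS := H.frameTwist_im_ne hweb hp
    have n1 := H.frameDeriv_normSq hp 1
    have nI := H.frameDeriv_normSq hp I
    field_simp
    linear_combination n1
  · intro p hp
    have hS := H.frameTwist_im_ne hweb hp
    have hpos := Real.exp_pos (M p)
    refine ⟨Or.inr ?_, Real.exp (M p), hpos, ?_⟩
    · rw [add_im, ofReal_im, im_ofReal_mul, I_im, mul_one, zero_add]
      exact hpos.ne'
    · apply Complex.ext
      · simp only [mul_re, add_re, ofReal_re, ofReal_im, I_re, I_im, add_im, mul_im]
        field_simp; ring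
      · simp only [mul_re, add_re, ofReal_re, ofReal_im, I_re, I_im, add_im, mul_im]
        field_simp; ring

/-- A number whose square is a positive real is real. -/
lemma eq_ofReal_of_sq_eq {z : ℂ} {r : ℝ} (hr : 0 < r) (hz : z ^ 2 = r) : z = (z.re : ℂ) := by
  have h1 : z.re * z.im + z.im * z.re = 0 := by
    have := congrArg Complex.im hz
    rwa [sq, mul_im, ofReal_im] at this
  have h2 : z.re * z.re - z.im * z.im = r := by
    have := congrArg Complex.re hz
    rwa [sq, mul_re, ofReal_re] at this
  have h3 : z.im = 0 := by
    rcases mul_eq_zero.1 (show z.re * z.im = 0 by linarith) with h | h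
    · rw [h] at h2; nlinarith [mul_self_nonneg z.im]
    · exact h
  apply Complex.ext <;> simp [h3]

theorem isConformallyFlat_second_net (hconn : IsConnected U) (hN₂ : IsOrthogonalNet U N₂)
    (hweb : IsWeb U (webOfNets N₁ N₂)) (hflat : IsConformallyFlat U N₁)
    (hθ : ∀ α, θ α ∈ abelianRelations U (webOfNets N₁ N₂) hU) (hli : LinearIndependent ℝ θ) :
    IsConformallyFlat U N₂ := by
  intro p hp
  obtain ⟨V, h, k, hpV, H⟩ := exists_adapted_chart hN₂ hflat hp
  obtain ⟨Φ, hΦ, hΦ'⟩ := H.exists_holomorphic_twist hweb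
    (H.compatibility hconn hN₂ hweb hflat hθ hli).1
  have hSp := H.frameTwist_im_ne hweb hpV
  -- `S` keeps its sign near `p`; the factor `c` compensates for it.
  obtain ⟨c, hc⟩ : ∃ c : ℂ, c ^ 2 = (SignType.sign (frameTwist h k p).im : ℝ) := by
    rcases lt_or_gt_of_ne hSp with hneg | hpos
    · exact ⟨I, by simp [hneg]⟩
    · exact ⟨1, by simp [hpos]⟩
  have hnear : ∀ᶠ q in 𝓝 p, q ∈ V ∧
      0 < (SignType.sign (frameTwist h k p).im : ℝ) * (frameTwist h k q).im := by
    have hcont : ContinuousAt (fun q => (SignType.sign (frameTwist h k p).im : ℝ)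
        * (frameTwist h k q).im) p := continuousAt_const.mul
      (H.contDiffOn_im.continuousOn.continuousAt (H.isOpen.mem_nhds hpV))
    refine (H.isOpen.eventually_mem hpV).and (hcont.eventually (lt_mem_nhds ?_))
    simp only [sign_mul_self]; exact abs_pos.2 hSp
  obtain ⟨r, hr, hball⟩ := Metric.eventually_nhds_iff_ball.1 hnear
  set ψ : ℂ → ℂ := fun q => c * h q * exp (-(log (Φ q) / 2)) with hψ
  have hψd : DifferentiableOn ℂ ψ (Metric.ball p r) := by
    have h1 : DifferentiableOn ℂ h (Metric.ball p r) := H.holo.mono fun q hq => (hball q hq).1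
    have h2 : DifferentiableOn ℂ (fun q => log (Φ q)) (Metric.ball p r) :=
      (hΦ.mono fun q hq => (hball q hq).1).clog fun q hq => (hΦ' q (hball q hq).1).1
    exact (h1.const_mul c).mul ((h2.div_const 2).neg.cexp)
  obtain ⟨g, hg⟩ := hψd.isExactOn_ball
  have hreal : ∀ q ∈ Metric.ball p r, ∃ ρ : ℝ, ρ ≠ 0 ∧ ψ q = ρ * k q := by
    intro q hq
    obtain ⟨hqV, hsgn⟩ := hball q hq
    obtain ⟨hslit, t, ht, hΦt⟩ := hΦ' q hqV
    have hh := H.h_ne q hqV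
    have hk := H.k_ne q hqV
    have hS := H.frameTwist_im_ne hweb hqV
    have hΦ0 : Φ q ≠ 0 := slitPlane_ne_zero hslit
    have hκ := H.div_ne hqV
    have hN : 0 < normSq (k q / h q) := normSq_pos.2 hκ
    have hexp : exp (-(log (Φ q) / 2)) ^ 2 = (Φ q)⁻¹ := by
      rw [← exp_nat_mul]
      have : ((2 : ℕ) : ℂ) * -(log (Φ q) / 2) = -log (Φ q) := by push_cast; ring
      rw [this, exp_neg, exp_log hΦ0]
    have htw : frameTwist h k q * (k q / h q) ^ 2 = normSq (k q / h q) := by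
      rw [frameTwist, normSq_eq_conj_mul_self]; field_simp
    have hsq : (ψ q / k q) ^ 2
        = (((SignType.sign (frameTwist h k p).im : ℝ) * (frameTwist h k q).im
            / (t * normSq (k q / h q)) : ℝ) : ℂ) := by
      have e1 : (ψ q / k q) ^ 2 = c ^ 2 * (Φ q)⁻¹ / (k q / h q) ^ 2 := by
        rw [← hexp, hψ]; field_simp
      rw [e1, hc]
      have hS' : ((frameTwist h k q).im : ℂ) ≠ 0 := by exact_mod_cast hS
      have ht' : (t : ℂ) ≠ 0 := by exact_mod_cast ht.ne'
      have hN' : (normSq (k q / h q) : ℂ) ≠ 0 := by exact_mod_cast hN.ne'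
      rw [ofReal_div, ofReal_mul, ofReal_mul, eq_div_iff (mul_ne_zero ht' hN'), ← htw]
      have hΦt' : (t : ℂ) * frameTwist h k q = Φ q * (frameTwist h k q).im := hΦt.symm
      calc _ = ((SignType.sign (frameTwist h k p).im : ℝ) : ℂ) * (Φ q)⁻¹
              * (t * frameTwist h k q) := by field_simp
        _ = _ := by rw [hΦt']; field_simp
    have hpos : 0 < (SignType.sign (frameTwist h k p).im : ℝ) * (frameTwist h k q).im
        / (t * normSq (k q / h q)) := div_pos hsgn (mul_pos ht hN)
    have hre := eq_ofReal_of_sq_eq hpos hsq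
    refine ⟨(ψ q / k q).re, ?_, ?_⟩
    · intro h0
      rw [h0, ofReal_zero] at hre
      rw [hre, zero_pow two_ne_zero] at hsq
      exact hpos.ne' (by exact_mod_cast hsq.symm)
    · rw [← hre, div_mul_cancel₀ _ hk]
  refine ⟨Metric.ball p r, Metric.isOpen_ball, Metric.mem_ball_self hr,
    fun q hq => H.subset (hball q hq).1, g,
    fun q hq => (hg q hq).differentiableAt.differentiableWithinAt, fun q hq => ?_⟩
  obtain ⟨ρ, hρ, hρk⟩ := hreal q hq
  have hqV := (hball q hq).1
  have hρ' : (ρ : ℂ) ≠ 0 := by exact_mod_cast hρ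
  rw [(hg q hq).deriv, hρk]
  refine ⟨mul_ne_zero hρ' (H.k_ne q hqV), fun w => ?_, fun w => ?_⟩
  · rw [H.mem_two_zero q hqV, mul_assoc, re_ofReal_mul]; simp [hρ]
  · rw [H.mem_two_one q hqV, mul_assoc, im_ofReal_mul]; simp [hρ]

end Triple

/-! ### The conic containing the two arcs of the first net -/

/-- The symmetric bilinear form `f₀g₁ + f₁g₀ - κ f₂g₂`. -/
def conicForm (κ : ℝ) (f g : Fin 3 → ℝ) : ℝ := f 0 * g 1 + f 1 * g 0 - κ * (f 2 * g 2)

lemma frameDeriv_conicForm {h : ℂ → ℂ} (κ : ℝ) {f g : Fin 3 → ℂ → ℝ} {p : ℂ}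
    (hf : ∀ j, DifferentiableAt ℝ (f j) p) (hg : ∀ j, DifferentiableAt ℝ (g j) p) (c : ℂ) :
    frameDeriv h c (fun q => conicForm κ (fun j => f j q) (fun j => g j q)) p
      = conicForm κ (fun j => frameDeriv h c (f j) p) (fun j => g j p)
        + conicForm κ (fun j => f j p) (fun j => frameDeriv h c (g j) p) := by
  simp only [conicForm]
  rw [frameDeriv_sub (((hf 0).fun_mul (hg 1)).fun_add ((hf 1).fun_mul (hg 0)))
      (((hf 2).fun_mul (hg 2)).const_mul κ),
    frameDeriv_add ((hf 0).fun_mul (hg 1)) ((hf 1).fun_mul (hg 0)),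
    frameDeriv_const_mul ((hf 2).fun_mul (hg 2)), frameDeriv_mul (hf 0) (hg 1),
    frameDeriv_mul (hf 1) (hg 0), frameDeriv_mul (hf 2) (hg 2)]
  ring

lemma differentiableAt_conicForm (κ : ℝ) {f g : Fin 3 → ℂ → ℝ} {p : ℂ}
    (hf : ∀ j, DifferentiableAt ℝ (f j) p) (hg : ∀ j, DifferentiableAt ℝ (g j) p) :
    DifferentiableAt ℝ (fun q => conicForm κ (fun j => f j q) (fun j => g j q)) p :=
  ((((hf 0).fun_mul (hg 1)).fun_add ((hf 1).fun_mul (hg 0)))).fun_sub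
    (((hf 2).fun_mul (hg 2)).const_mul κ)

section Conic

variable {U : Set ℂ} {hU : IsOpen U} {N₁ N₂ : Fin 2 → DirectionField} {V : Set ℂ} {h k : ℂ → ℂ}
  {θ : Fin 3 → Fin 4 → ℂ → ℂ →L[ℝ] ℝ}

/-- The products of the vectors `a, b, y` of jets with respect to `conicForm κ` which have to
vanish: `⟨a, a⟩`, `⟨b, b⟩`, `⟨a, y⟩`, `⟨b, y⟩` and `⟨y, y⟩ + K⟨a, b⟩` with `K = ∂ᵥX`. -/
noncomputable def conicDefect (h k : ℂ → ℂ) (κ : ℝ) (θ : Fin 3 → Fin 4 → ℂ → ℂ →L[ℝ] ℝ) :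
    Fin 5 → ℂ → ℝ :=
  ![fun q => conicForm κ (fun j => frameComp h 0 1 (θ j) q) (fun j => frameComp h 0 1 (θ j) q),
    fun q => conicForm κ (fun j => frameComp h 1 I (θ j) q) (fun j => frameComp h 1 I (θ j) q),
    fun q => conicForm κ (fun j => frameComp h 0 1 (θ j) q) (fun j => frameJet h k (θ j) q),
    fun q => conicForm κ (fun j => frameComp h 1 I (θ j) q) (fun j => frameJet h k (θ j) q),
    fun q => conicForm κ (fun j => frameJet h k (θ j) q) (fun j => frameJet h k (θ j) q)
      + frameDeriv h I (coeffU h k) q *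
        conicForm κ (fun j => frameComp h 0 1 (θ j) q) (fun j => frameComp h 1 I (θ j) q)]

namespace IsAdaptedChart

lemma differentiableAt_conicDefect (H : IsAdaptedChart U N₁ N₂ V h k)
    (hweb : IsWeb U (webOfNets N₁ N₂))
    (hθ : ∀ α, θ α ∈ abelianRelations U (webOfNets N₁ N₂) hU) (κ : ℝ) (i : Fin 5) {p : ℂ}
    (hp : p ∈ V) : DifferentiableAt ℝ (conicDefect h k κ θ i) p := by
  have da : ∀ j, DifferentiableAt ℝ (frameComp h 0 1 (θ j)) p := fun j =>
    differentiableAt_of_contDiffOn H.isOpen (H.contDiffOn_frameComp (hθ j) 0 1) hp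
  have db : ∀ j, DifferentiableAt ℝ (frameComp h 1 I (θ j)) p := fun j =>
    differentiableAt_of_contDiffOn H.isOpen (H.contDiffOn_frameComp (hθ j) 1 I) hp
  have dy : ∀ j, DifferentiableAt ℝ (frameJet h k (θ j)) p := fun j =>
    differentiableAt_of_contDiffOn H.isOpen (H.contDiffOn_frameJet hweb (hθ j)) hp
  have dK : DifferentiableAt ℝ (frameDeriv h I (coeffU h k)) p :=
    differentiableAt_of_contDiffOn H.isOpen
      (H.contDiffOn_frameDeriv (H.contDiffOn_coeffU hweb) I) hp
  fin_cases i
  · exact differentiableAt_conicForm κ da da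
  · exact differentiableAt_conicForm κ db db
  · exact differentiableAt_conicForm κ da dy
  · exact differentiableAt_conicForm κ db dy
  · exact (differentiableAt_conicForm κ dy dy).add (dK.mul (differentiableAt_conicForm κ da db))

lemma frameDeriv_conicDefect (hconn : IsConnected U) (hN₂ : IsOrthogonalNet U N₂)
    (hweb : IsWeb U (webOfNets N₁ N₂)) (hflat : IsConformallyFlat U N₁)
    (hθ : ∀ α, θ α ∈ abelianRelations U (webOfNets N₁ N₂) hU) (hli : LinearIndependent ℝ θ)
    {Θ : Fin 3 → Fin 4 → ℂ → ℂ →L[ℝ] ℝ}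
    (hΘ : ∀ α, Θ α ∈ abelianRelations U (webOfNets N₁ N₂) hU)
    (H : IsAdaptedChart U N₁ N₂ V h k) (κ : ℝ) {p : ℂ} (hp : p ∈ V) :
    (frameDeriv h 1 (conicDefect h k κ Θ 0) p
        = 2 * conicDefect h k κ Θ 2 p - 2 * coeffU h k p * conicDefect h k κ Θ 0 p ∧
      frameDeriv h I (conicDefect h k κ Θ 0) p = 0) ∧
    (frameDeriv h 1 (conicDefect h k κ Θ 1) p = 0 ∧
      frameDeriv h I (conicDefect h k κ Θ 1) p
        = 2 * conicDefect h k κ Θ 3 p - 2 * coeffV h k p * conicDefect h k κ Θ 1 p) ∧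
    (frameDeriv h 1 (conicDefect h k κ Θ 2) p
        = conicDefect h k κ Θ 4 p - coeffU h k p * conicDefect h k κ Θ 2 p ∧
      frameDeriv h I (conicDefect h k κ Θ 2) p
        = frameDeriv h I (coeffU h k) p * conicDefect h k κ Θ 0 p) ∧
    (frameDeriv h 1 (conicDefect h k κ Θ 3) p
        = frameDeriv h I (coeffU h k) p * conicDefect h k κ Θ 1 p ∧
      frameDeriv h I (conicDefect h k κ Θ 3) p
        = conicDefect h k κ Θ 4 p - coeffV h k p * conicDefect h k κ Θ 3 p) ∧
    (frameDeriv h 1 (conicDefect h k κ Θ 4) p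
        = 3 * frameDeriv h I (coeffU h k) p * conicDefect h k κ Θ 3 p ∧
      frameDeriv h I (conicDefect h k κ Θ 4) p
        = 3 * frameDeriv h I (coeffU h k) p * conicDefect h k κ Θ 2 p) := by
  obtain ⟨h1, hKu, hKv⟩ := H.compatibility hconn hN₂ hweb hflat hθ hli
  have da : ∀ j, DifferentiableAt ℝ (frameComp h 0 1 (Θ j)) p := fun j =>
    differentiableAt_of_contDiffOn H.isOpen (H.contDiffOn_frameComp (hΘ j) 0 1) hp
  have db : ∀ j, DifferentiableAt ℝ (frameComp h 1 I (Θ j)) p := fun j =>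
    differentiableAt_of_contDiffOn H.isOpen (H.contDiffOn_frameComp (hΘ j) 1 I) hp
  have dy : ∀ j, DifferentiableAt ℝ (frameJet h k (Θ j)) p := fun j =>
    differentiableAt_of_contDiffOn H.isOpen (H.contDiffOn_frameJet hweb (hΘ j)) hp
  have dK : DifferentiableAt ℝ (frameDeriv h I (coeffU h k)) p :=
    differentiableAt_of_contDiffOn H.isOpen
      (H.contDiffOn_frameDeriv (H.contDiffOn_coeffU hweb) I) hp
  have ea1 : ∀ j, frameDeriv h 1 (frameComp h 0 1 (Θ j)) p
      = frameJet h k (Θ j) p - coeffU h k p * frameComp h 0 1 (Θ j) p := fun j =>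
    congrFun frameDeriv_one_comp_zero p
  have eaI : ∀ j, frameDeriv h I (frameComp h 0 1 (Θ j)) p = 0 := fun j =>
    H.frameDeriv_comp_zero (hΘ j) hp
  have eb1 : ∀ j, frameDeriv h 1 (frameComp h 1 I (Θ j)) p = 0 := fun j =>
    H.frameDeriv_comp_one (hΘ j) hp
  have ebI : ∀ j, frameDeriv h I (frameComp h 1 I (Θ j)) p
      = frameJet h k (Θ j) p - coeffV h k p * frameComp h 1 I (Θ j) p := fun j =>
    H.frameDeriv_I_comp_one hweb (hΘ j) hp
  have ey1 : ∀ j, frameDeriv h 1 (frameJet h k (Θ j)) p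
      = frameDeriv h I (coeffU h k) p * frameComp h 1 I (Θ j) p := fun j => by
    rw [H.frameDeriv_one_jet hweb (hΘ j) hp, h1 p hp]
  have eyI : ∀ j, frameDeriv h I (frameJet h k (Θ j)) p
      = frameDeriv h I (coeffU h k) p * frameComp h 0 1 (Θ j) p := fun j =>
    H.frameDeriv_I_jet hweb (hΘ j) hp
  have dab := differentiableAt_conicForm κ da db
  have dyy := differentiableAt_conicForm κ dy dy
  refine ⟨⟨?_, ?_⟩, ⟨?_, ?_⟩, ⟨?_, ?_⟩, ⟨?_, ?_⟩, ⟨?_, ?_⟩⟩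
  · refine (frameDeriv_conicForm κ da da 1).trans ?_
    simp only [conicDefect, conicForm, ea1, Matrix.cons_val]; ring
  · refine (frameDeriv_conicForm κ da da I).trans ?_
    simp only [conicForm, eaI]; ring
  · refine (frameDeriv_conicForm κ db db 1).trans ?_
    simp only [conicForm, eb1]; ring
  · refine (frameDeriv_conicForm κ db db I).trans ?_
    simp only [conicDefect, conicForm, ebI, Matrix.cons_val]; ring
  · refine (frameDeriv_conicForm κ da dy 1).trans ?_
    simp only [conicDefect, conicForm, ea1, ey1, Matrix.cons_val]; ring
  · refine (frameDeriv_conicForm κ da dy I).trans ?_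
    simp only [conicDefect, conicForm, eaI, eyI, Matrix.cons_val]; ring
  · refine (frameDeriv_conicForm κ db dy 1).trans ?_
    simp only [conicDefect, conicForm, eb1, ey1, Matrix.cons_val]; ring
  · refine (frameDeriv_conicForm κ db dy I).trans ?_
    simp only [conicDefect, conicForm, ebI, eyI, Matrix.cons_val]; ring
  · change frameDeriv h 1 (fun q => conicForm κ _ _ + _ * conicForm κ _ _) p = _
    rw [frameDeriv_add dyy (dK.fun_mul dab), frameDeriv_mul dK dab, frameDeriv_conicForm κ dy dy,
      frameDeriv_conicForm κ da db, hKu p hp]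
    simp only [conicDefect, conicForm, ea1, eb1, ey1, Matrix.cons_val]; ring
  · change frameDeriv h I (fun q => conicForm κ _ _ + _ * conicForm κ _ _) p = _
    rw [frameDeriv_add dyy (dK.fun_mul dab), frameDeriv_mul dK dab, frameDeriv_conicForm κ dy dy,
      frameDeriv_conicForm κ da db, hKv p hp]
    simp only [conicDefect, conicForm, eaI, ebI, eyI, Matrix.cons_val]; ring

lemma conicDefect_eqOn_zero (hconn : IsConnected U) (hN₂ : IsOrthogonalNet U N₂)
    (hweb : IsWeb U (webOfNets N₁ N₂)) (hflat : IsConformallyFlat U N₁)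
    (hθ : ∀ α, θ α ∈ abelianRelations U (webOfNets N₁ N₂) hU) (hli : LinearIndependent ℝ θ)
    {Θ : Fin 3 → Fin 4 → ℂ → ℂ →L[ℝ] ℝ}
    (hΘ : ∀ α, Θ α ∈ abelianRelations U (webOfNets N₁ N₂) hU)
    (H : IsAdaptedChart U N₁ N₂ V h k) (κ : ℝ) {p : ℂ} (hp : p ∈ V)
    (h_init : ∀ i, conicDefect h k κ Θ i p = 0) : ∀ i, ∀ q ∈ V, conicDefect h k κ Θ i q = 0 := by
  have cX := (H.contDiffOn_coeffU hweb).continuousOn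
  have cY := (H.contDiffOn_coeffV hweb).continuousOn
  have cK := (H.contDiffOn_frameDeriv (H.contDiffOn_coeffU hweb) I).continuousOn
  have c3K : ContinuousOn (fun q => 3 * frameDeriv h I (coeffU h k) q) V :=
    continuousOn_const.mul cK
  have c2X : ContinuousOn (fun q => -(2 * coeffU h k q)) V := (continuousOn_const.mul cX).neg
  have c2Y : ContinuousOn (fun q => -(2 * coeffV h k q)) V := (continuousOn_const.mul cY).neg
  have hd := fun q hq => H.frameDeriv_conicDefect hconn hN₂ hweb hflat hθ hli hΘ κ (p := q) hq
  refine eqOn_zero_of_linear_system (h := h) H.convex H.holo.continuousOn H.h_ne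
    (A := ![![fun q => -(2 * coeffU h k q), 0, fun _ => 2, 0, 0], 0,
      ![0, 0, fun q => -coeffU h k q, 0, fun _ => 1],
      ![0, frameDeriv h I (coeffU h k), 0, 0, 0],
      ![0, 0, 0, fun q => 3 * frameDeriv h I (coeffU h k) q, 0]])
    (B := ![0, ![0, fun q => -(2 * coeffV h k q), 0, fun _ => 2, 0],
      ![frameDeriv h I (coeffU h k), 0, 0, 0, 0],
      ![0, 0, 0, fun q => -coeffV h k q, fun _ => 1],
      ![0, 0, fun q => 3 * frameDeriv h I (coeffU h k) q, 0, 0]])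
    (fun i q hq => H.differentiableAt_conicDefect hweb hΘ κ i hq) ?_ ?_ ?_ ?_ hp h_init
  · intro i j
    fin_cases i <;> fin_cases j <;>
      first | exact continuousOn_const | exact cX.neg | exact cK | exact c3K | exact c2X
  · intro i j
    fin_cases i <;> fin_cases j <;>
      first | exact continuousOn_const | exact cY.neg | exact cK | exact c3K | exact c2Y
  · intro i q hq
    obtain ⟨⟨h01, -⟩, ⟨h11, -⟩, ⟨h21, -⟩, ⟨h31, -⟩, ⟨h41, -⟩⟩ := hd q hq
    fin_cases i
    · simp [Fin.sum_univ_five, h01]; ring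
    · simp [h11]
    · simp [Fin.sum_univ_five, h21]; ring
    · simp [Fin.sum_univ_five, h31]
    · simp [Fin.sum_univ_five, h41]
  · intro i q hq
    obtain ⟨⟨-, h01⟩, ⟨-, h11⟩, ⟨-, h21⟩, ⟨-, h31⟩, ⟨-, h41⟩⟩ := hd q hq
    fin_cases i
    · simp [h01]
    · simp [Fin.sum_univ_five, h11]; ring
    · simp [Fin.sum_univ_five, h21]
    · simp [Fin.sum_univ_five, h31]; ring
    · simp [Fin.sum_univ_five, h41]

/-- If the two arcs lie on the conic near one point, all products vanish there: they are obtained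
from `⟨a, a⟩` and `⟨b, b⟩` by differentiation. -/
lemma conicDefect_eq_zero_of_eventually (hconn : IsConnected U) (hN₂ : IsOrthogonalNet U N₂)
    (hweb : IsWeb U (webOfNets N₁ N₂)) (hflat : IsConformallyFlat U N₁)
    (hθ : ∀ α, θ α ∈ abelianRelations U (webOfNets N₁ N₂) hU) (hli : LinearIndependent ℝ θ)
    {Θ : Fin 3 → Fin 4 → ℂ → ℂ →L[ℝ] ℝ}
    (hΘ : ∀ α, Θ α ∈ abelianRelations U (webOfNets N₁ N₂) hU)
    (H : IsAdaptedChart U N₁ N₂ V h k) (κ : ℝ) {p : ℂ} (hp : p ∈ V)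
    (hz : ∀ᶠ q in 𝓝 p, conicDefect h k κ Θ 0 q = 0 ∧ conicDefect h k κ Θ 1 q = 0) :
    ∀ i, conicDefect h k κ Θ i p = 0 := by
  have hd := fun q hq => H.frameDeriv_conicDefect hconn hN₂ hweb hflat hθ hli hΘ κ (p := q) hq
  have hz2 : ∀ᶠ q in 𝓝 p, conicDefect h k κ Θ 2 q = 0 ∧ conicDefect h k κ Θ 3 q = 0 := by
    filter_upwards [hz.eventually_nhds, H.isOpen.eventually_mem hp] with q hq hqV
    obtain ⟨⟨h01, -⟩, ⟨-, h11⟩, -⟩ := hd q hqV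
    rw [frameDeriv_eq_zero_of_eventuallyEq (hq.mono fun _ hw => hw.1), hq.self_of_nhds.1] at h01
    rw [frameDeriv_eq_zero_of_eventuallyEq (hq.mono fun _ hw => hw.2), hq.self_of_nhds.2] at h11
    constructor <;> linarith
  obtain ⟨-, -, ⟨h21, -⟩, -⟩ := hd p hp
  rw [frameDeriv_eq_zero_of_eventuallyEq (hz2.mono fun _ hw => hw.1), hz2.self_of_nhds.1] at h21
  intro i
  fin_cases i
  · exact hz.self_of_nhds.1
  · exact hz.self_of_nhds.2
  · exact hz2.self_of_nhds.1
  · exact hz2.self_of_nhds.2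
  · change conicDefect h k κ Θ 4 p = 0
    linarith

end IsAdaptedChart

/-- Three relations with prescribed jets at a point form the dual basis; in it, the equation of
the conic is `2 ℓ₀ ℓ₁ = K ℓ₂²`. -/
theorem exists_conic_of_first_net (hconn : IsConnected U) (hN₂ : IsOrthogonalNet U N₂)
    (hweb : IsWeb U (webOfNets N₁ N₂)) (hflat : IsConformallyFlat U N₁)
    (hθ : ∀ α, θ α ∈ abelianRelations U (webOfNets N₁ N₂) hU) (hli : LinearIndependent ℝ θ) :
    ∃ Q : MvPolynomial (Fin 3) ℝ, IsConic Q ∧ ∀ p ∈ U, ∀ v : ℂ,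
      MvPolynomial.eval (fun α => θ α 0 p v) Q = 0 ∧
      MvPolynomial.eval (fun α => θ α 1 p v) Q = 0 := by
  obtain ⟨p₀, hp₀⟩ := hconn.nonempty
  obtain ⟨V, h, k, hpV, H⟩ := exists_adapted_chart hN₂ hflat hp₀
  have hu := H.isUnit_jetMatrix hconn hN₂ hweb hflat hθ hli hpV
  set M := jetMatrix h k θ p₀ with hM
  have hMM : M * M⁻¹ = 1 := Matrix.mul_nonsing_inv M ((Matrix.isUnit_iff_isUnit_det M).1 hu)
  set e : Fin 3 → Fin 3 → ℝ := fun j α => M⁻¹ α j with he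
  set Θ : Fin 3 → Fin 4 → ℂ → ℂ →L[ℝ] ℝ := fun j => ∑ α, e j α • θ α with hΘdef
  have hΘ : ∀ j, Θ j ∈ abelianRelations U (webOfNets N₁ N₂) hU := fun j => combination_mem hθ (e j)
  have hdual : ∀ i j, ∑ α, M i α * e j α = (1 : Matrix (Fin 3) (Fin 3) ℝ) i j := fun i j => by
    rw [← hMM, Matrix.mul_apply]
  set κ := frameDeriv h I (coeffU h k) p₀ with hκ
  set ℓ : Fin 3 → MvPolynomial (Fin 3) ℝ := fun j =>
    ∑ α, MvPolynomial.C (e j α) * MvPolynomial.X α with hℓ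
  have hℓhom : ∀ j, (ℓ j).IsHomogeneous 1 := fun j =>
    MvPolynomial.IsHomogeneous.sum _ _ _ fun α _ => MvPolynomial.isHomogeneous_C_mul_X _ _
  have hℓeval : ∀ j x, MvPolynomial.eval x (ℓ j) = ∑ α, e j α * x α := fun j x => by
    simp [hℓ]
  set Q : MvPolynomial (Fin 3) ℝ :=
    MvPolynomial.C 2 * (ℓ 0 * ℓ 1) - MvPolynomial.C κ * (ℓ 2 * ℓ 2) with hQ
  have hQeval : ∀ i p v, MvPolynomial.eval (fun α => θ α i p v) Q
      = conicForm κ (fun j => Θ j i p v) (fun j => Θ j i p v) := by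
    intro i p v
    have hval : ∀ j, MvPolynomial.eval (fun α => θ α i p v) (ℓ j) = Θ j i p v := fun j => by
      rw [hℓeval]; simp [hΘdef, Finset.sum_apply]
    simp only [hQ, map_sub, map_mul, MvPolynomial.eval_C, hval, conicForm]
    ring
  refine ⟨Q, ⟨?_, ?_⟩, ?_⟩
  · exact (((hℓhom 0).mul (hℓhom 1)).C_mul 2).sub (((hℓhom 2).mul (hℓhom 2)).C_mul κ)
  · intro hQ0
    have hval : ∀ j, MvPolynomial.eval (fun α => M 0 α + M 1 α) (ℓ j)
        = (1 : Matrix (Fin 3) (Fin 3) ℝ) 0 j + (1 : Matrix (Fin 3) (Fin 3) ℝ) 1 j := fun j => by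
      rw [hℓeval, ← hdual, ← hdual, ← Finset.sum_add_distrib]
      exact Finset.sum_congr rfl fun α _ => by ring
    have := congrArg (MvPolynomial.eval fun α => M 0 α + M 1 α) hQ0
    simp only [hQ, map_sub, map_mul, MvPolynomial.eval_C, hval, map_zero] at this
    simp at this
  · have key := forall_mem_of_local_spread (U := U)
      (P := fun q => ∀ v, conicForm κ (fun j => Θ j 0 q v) (fun j => Θ j 0 q v) = 0 ∧
        conicForm κ (fun j => Θ j 1 q v) (fun j => Θ j 1 q v) = 0)
    have hchart : ∀ {V' : Set ℂ} {h' k' : ℂ → ℂ}, IsAdaptedChart U N₁ N₂ V' h' k' → ∀ q ∈ V',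
        conicDefect h' k' κ Θ 0 q = 0 → conicDefect h' k' κ Θ 1 q = 0 →
        ∀ v, conicForm κ (fun j => Θ j 0 q v) (fun j => Θ j 0 q v) = 0 ∧
          conicForm κ (fun j => Θ j 1 q v) (fun j => Θ j 1 q v) = 0 := by
      intro V' h' k' H' q hq h0 h1 v
      simp only [conicDefect, Matrix.cons_val, conicForm] at h0 h1
      simp only [conicForm, H'.apply_zero (hΘ _) hq v, H'.apply_one (hΘ _) hq v]
      constructor
      · linear_combination (h' q * v).re ^ 2 * h0
      · linear_combination (h' q * v).im ^ 2 * h1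
    have hall := key hconn.isPreconnected ?_ hp₀ ?_
    · intro p hp v
      rw [hQeval, hQeval]
      exact hall p hp v
    · intro p hp
      obtain ⟨V', h', k', hpV', H'⟩ := exists_adapted_chart hN₂ hflat hp
      refine ⟨V', H'.isOpen, hpV', ?_⟩
      rintro ⟨q, hq, hev⟩
      have h0 := H'.conicDefect_eq_zero_of_eventually hconn hN₂ hweb hflat hθ hli hΘ κ hq
        (hev.mono fun z hz => ⟨(hz (1 / h' z)).1, (hz (I / h' z)).2⟩)
      have hV' := H'.conicDefect_eqOn_zero hconn hN₂ hweb hflat hθ hli hΘ κ hq h0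
      exact fun z hz => hchart H' z hz (hV' 0 z hz) (hV' 1 z hz)
    · have ha : ∀ j, frameComp h 0 1 (Θ j) p₀ = (1 : Matrix (Fin 3) (Fin 3) ℝ) 0 j := fun j => by
        rw [frameComp_combination, ← hdual]
        exact Finset.sum_congr rfl fun α _ => mul_comm _ _
      have hb : ∀ j, frameComp h 1 I (Θ j) p₀ = (1 : Matrix (Fin 3) (Fin 3) ℝ) 1 j := fun j => by
        rw [frameComp_combination, ← hdual]
        exact Finset.sum_congr rfl fun α _ => mul_comm _ _
      have hy : ∀ j, frameJet h k (Θ j) p₀ = (1 : Matrix (Fin 3) (Fin 3) ℝ) 2 j := fun j => by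
        rw [H.frameJet_combination hθ _ hpV, ← hdual]
        exact Finset.sum_congr rfl fun α _ => mul_comm _ _
      have h0 : ∀ i, conicDefect h k κ Θ i p₀ = 0 := by
        intro i
        fin_cases i <;> simp [conicDefect, conicForm, ha, hb, hy, ← hκ]
      have hV := H.conicDefect_eqOn_zero hconn hN₂ hweb hflat hθ hli hΘ κ hpV h0
      exact eventually_of_mem (H.isOpen.mem_nhds hpV) fun z hz =>
        hchart H z hz (hV 0 z hz) (hV 1 z hz)

end Conic

/-! ### Homogeneous polynomials on planes -/

namespace MvPolynomial

lemma eval_smul_of_isHomogeneous {σ : Type*} {G : MvPolynomial σ ℝ} {d : ℕ} (hG : G.IsHomogeneous d)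
    (t : ℝ) (x : σ → ℝ) : eval (t • x) G = t ^ d * eval x G := by
  rw [eval_eq, eval_eq, Finset.mul_sum]
  refine Finset.sum_congr rfl fun m hm => ?_
  have hdeg : ∑ i ∈ m.support, m i = d := (hG.degree_eq_sum_deg_support hm).symm
  simp only [Pi.smul_apply, smul_eq_mul, mul_pow, Finset.prod_mul_distrib,
    Finset.prod_pow_eq_pow_sum, hdeg]
  ring

/-- A form of degree `d` that vanishes at more than `d` points of a projective line vanishes on the
line. The points are given by their homogeneous coordinates `(m i : n i)`. -/
lemma eval_eq_zero_of_card_lt {σ ι : Type*} [Fintype ι] {G : MvPolynomial σ ℝ}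
    {d : ℕ} (hG : G.IsHomogeneous d) (x y : σ → ℝ) (m n : ι → ℝ)
    (hne : ∀ i, m i = 0 → n i ≠ 0) (hdet : ∀ i j, i ≠ j → m i * n j ≠ m j * n i)
    (hcard : d < Fintype.card ι) (hz : ∀ i, eval (m i • x + n i • y) G = 0) (s t : ℝ) :
    eval (s • x + t • y) G = 0 := by
  classical
  -- No point of the family is proportional to `x + τ y`, which serves as the point at infinity.
  obtain ⟨τ, hτ⟩ := Infinite.exists_notMem_finset (Finset.univ.image fun i => n i / m i)
  have hτ' : ∀ i, n i - m i * τ ≠ 0 := by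
    intro i h0
    by_cases hm : m i = 0
    · exact hne i hm (by rw [hm] at h0; linarith)
    · exact hτ (Finset.mem_image.2 ⟨i, Finset.mem_univ _, by field_simp; linarith⟩)
  set g : Polynomial ℝ := aeval (fun a => Polynomial.C (y a)
    + Polynomial.C (x a + τ * y a) * Polynomial.X) G with hg
  have hgeval : ∀ u, g.eval u = eval (y + u • (x + τ • y)) G := by
    intro u
    have e : (Polynomial.aeval u).comp (aeval (fun a => Polynomial.C (y a)
        + Polynomial.C (x a + τ * y a) * Polynomial.X))
        = (aeval (y + u • (x + τ • y)) : MvPolynomial σ ℝ →ₐ[ℝ] ℝ) := by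
      ext a; simp; ring
    have := DFunLike.congr_fun e G
    rw [AlgHom.comp_apply] at this
    rw [← MvPolynomial.coe_aeval_eq_eval, RingHom.coe_coe, ← this, hg]
    simp [Polynomial.aeval_def, Polynomial.eval₂_eq_eval_map]
  have hdeg : g.natDegree ≤ d := by
    refine (MvPolynomial.aeval_natDegree_le G hG.totalDegree_le _ fun a => ?_).trans_eq (mul_one d)
    refine Polynomial.natDegree_add_le_of_degree_le (by simp)
      ((Polynomial.natDegree_C_mul_le _ _).trans Polynomial.natDegree_X_le)
  have hinj : Function.Injective fun i => m i / (n i - m i * τ) := by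
    intro i j hij
    by_contra hne'
    apply hdet i j hne'
    simp only at hij
    rw [div_eq_div_iff (hτ' i) (hτ' j)] at hij
    linarith
  have hg0 : g = 0 := by
    refine Polynomial.eq_zero_of_natDegree_lt_card_of_eval_eq_zero g hinj (fun i => ?_)
      (hdeg.trans_lt hcard)
    rw [hgeval]
    have h1 : m i • x + n i • y
        = (n i - m i * τ) • (y + (m i / (n i - m i * τ)) • (x + τ • y)) := by
      funext a
      have := hτ' i
      simp only [Pi.add_apply, Pi.smul_apply, smul_eq_mul]
      field_simp; ring
    have h2 := hz i
    rw [h1, eval_smul_of_isHomogeneous hG] at h2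
    exact (mul_eq_zero.1 h2).resolve_left (pow_ne_zero _ (hτ' i))
  have hfin : ∀ s t : ℝ, t - s * τ ≠ 0 → eval (s • x + t • y) G = 0 := by
    intro s t hst
    have h1 : s • x + t • y = (t - s * τ) • (y + (s / (t - s * τ)) • (x + τ • y)) := by
      funext a
      simp only [Pi.add_apply, Pi.smul_apply, smul_eq_mul]
      field_simp; ring
    rw [h1, eval_smul_of_isHomogeneous hG, ← hgeval, hg0, Polynomial.eval_zero, mul_zero]
  -- The point at infinity itself is reached by continuity.
  have hcont : Continuous fun t : ℝ => eval (s • x + t • y) G :=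
    (MvPolynomial.continuous_eval G).comp (by fun_prop)
  have hclosed : IsClosed {t : ℝ | eval (s • x + t • y) G = 0} :=
    isClosed_eq hcont continuous_const
  have hdense : Dense ({s * τ}ᶜ : Set ℝ) := dense_compl_singleton _
  exact hclosed.closure_subset_iff.2
    (fun t (ht : t ≠ s * τ) => hfin s t (sub_ne_zero.2 ht)) (hdense t)

/-- A form that vanishes on the plane `∑ r α X α = 0` is divisible by `∑ r α X α`. -/
lemma exists_eq_linear_mul {σ : Type*} [Fintype σ] {G : MvPolynomial σ ℝ} {d : ℕ}
    (hG : G.IsHomogeneous (d + 1)) {r : σ → ℝ} (hr : r ≠ 0)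
    (hz : ∀ z : σ → ℝ, ∑ a, r a * z a = 0 → eval z G = 0) :
    ∃ G' : MvPolynomial σ ℝ, G'.IsHomogeneous d ∧ G = (∑ a, C (r a) * X a) * G' := by
  classical
  obtain ⟨c, hc⟩ : ∃ c, r c ≠ 0 := Function.ne_iff.1 hr
  set L : MvPolynomial σ ℝ := ∑ a, C (r a) * X a with hL
  -- The substitution `π` projects onto the plane along the `c`-th coordinate axis.
  set π : MvPolynomial σ ℝ →ₐ[ℝ] MvPolynomial σ ℝ :=
    aeval fun a => X a - if a = c then C (r c)⁻¹ * L else 0 with hπ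
  have hmod : L ∣ G - π G := by
    rw [← Ideal.mem_span_singleton, ← Ideal.Quotient.eq]
    have : Ideal.Quotient.mkₐ ℝ (Ideal.span {L})
        = (Ideal.Quotient.mkₐ ℝ (Ideal.span {L})).comp π := by
      ext a
      simp only [AlgHom.comp_apply, hπ, aeval_X, Ideal.Quotient.mkₐ_eq_mk]
      rw [Ideal.Quotient.eq, sub_sub_cancel, Ideal.mem_span_singleton]
      split_ifs
      · exact dvd_mul_left _ _
      · exact dvd_zero _
    exact DFunLike.congr_fun this G
  have hπG : π G = 0 := by
    apply MvPolynomial.funext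
    intro z
    have e : (aeval z : MvPolynomial σ ℝ →ₐ[ℝ] ℝ).comp π
        = aeval fun a => z a - if a = c then (r c)⁻¹ * ∑ b, r b * z b else 0 := by
      ext a
      simp only [AlgHom.comp_apply, hπ, aeval_X, map_sub, apply_ite (aeval z), map_mul, map_zero]
      simp [hL]
    have h1 := DFunLike.congr_fun e G
    rw [AlgHom.comp_apply] at h1
    rw [map_zero]
    refine h1.trans (hz _ ?_)
    simp only [mul_sub, Finset.sum_sub_distrib, mul_ite, mul_zero, Finset.sum_ite_eq',
      Finset.mem_univ, if_true]
    field_simp; ring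
  rw [hπG, sub_zero] at hmod
  obtain ⟨G', hG'⟩ := hmod
  have hLhom : L.IsHomogeneous 1 :=
    IsHomogeneous.sum _ _ _ fun a _ => isHomogeneous_C_mul_X _ _
  refine ⟨homogeneousComponent d G', homogeneousComponent_isHomogeneous d G', ?_⟩
  have h1 : homogeneousComponent (d + 1) G = G := homogeneousComponent_eq_self hG
  rw [← h1, hG']
  conv_lhs => rw [← sum_homogeneousComponent G', Finset.mul_sum, map_sum]
  have h2 : ∀ j, homogeneousComponent (d + 1) (L * homogeneousComponent j G')
      = if j = d then L * homogeneousComponent j G' else 0 := by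
    intro j
    rw [homogeneousComponent_of_mem (hLhom.mul (homogeneousComponent_isHomogeneous j G'))]
    have : (d + 1 = 1 + j) ↔ j = d := by omega
    simp only [this]
  simp only [h2, Finset.sum_ite_eq', Finset.mem_range]
  split_ifs with h
  · rfl
  · rw [homogeneousComponent_eq_zero d G' (by omega), mul_zero]

end MvPolynomial

/-! ### Interchanging the two nets -/

section Swap

variable {U : Set ℂ} {hU : IsOpen U} {N₁ N₂ : Fin 2 → DirectionField}
  {θ : Fin 3 → Fin 4 → ℂ → ℂ →L[ℝ] ℝ}

lemma webOfNets_swap (N₁ N₂ : Fin 2 → DirectionField) (i : Fin 4) :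
    webOfNets N₂ N₁ i = webOfNets N₁ N₂ (i + 2) := by
  fin_cases i <;> rfl

lemma IsWeb.swap (hweb : IsWeb U (webOfNets N₁ N₂)) : IsWeb U (webOfNets N₂ N₁) where
  foliation i := by rw [webOfNets_swap]; exact hweb.foliation _
  transverse p hp i j hij := by
    rw [webOfNets_swap N₁ N₂ i, webOfNets_swap N₁ N₂ j]
    exact hweb.transverse p hp _ _ fun h => hij (add_right_cancel h)

lemma mem_abelianRelations_swap {τ : Fin 4 → ℂ → ℂ →L[ℝ] ℝ}
    (hτ : τ ∈ abelianRelations U (webOfNets N₁ N₂) hU) :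
    (fun i => τ (i + 2)) ∈ abelianRelations U (webOfNets N₂ N₁) hU := by
  obtain ⟨h1, h2, h3, h4, h5⟩ := hτ
  refine ⟨fun i => h1 _, fun i => h2 _, fun i p hp v hv => ?_, fun i => h4 _, fun p hp => ?_⟩
  · rw [webOfNets_swap] at hv
    exact h3 _ p hp v hv
  · rw [← h5 p hp]
    exact Equiv.sum_comp (Equiv.addRight (2 : Fin 4)) fun i => τ i p

lemma linearIndependent_swap (hli : LinearIndependent ℝ θ) :
    LinearIndependent ℝ fun α (i : Fin 4) => θ α (i + 2) := by
  rw [Fintype.linearIndependent_iff] at hli ⊢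
  intro g hg
  refine hli g ?_
  funext i
  have := congrFun hg (i - 2)
  simpa [Finset.sum_apply] using this

lemma exists_conic_of_second_net (hconn : IsConnected U) (hN₁ : IsOrthogonalNet U N₁)
    (hweb : IsWeb U (webOfNets N₁ N₂)) (hflat : IsConformallyFlat U N₂)
    (hθ : ∀ α, θ α ∈ abelianRelations U (webOfNets N₁ N₂) hU) (hli : LinearIndependent ℝ θ) :
    ∃ Q : MvPolynomial (Fin 3) ℝ, IsConic Q ∧ ∀ p ∈ U, ∀ v : ℂ,
      MvPolynomial.eval (fun α => θ α 2 p v) Q = 0 ∧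
      MvPolynomial.eval (fun α => θ α 3 p v) Q = 0 := by
  obtain ⟨Q, hQ, hz⟩ := exists_conic_of_first_net hconn hN₁ hweb.swap hflat
    (fun α => mem_abelianRelations_swap (hθ α)) (linearIndependent_swap hli)
  have h2 : (0 + 2 : Fin 4) = 2 := rfl
  have h3 : (1 + 2 : Fin 4) = 3 := rfl
  refine ⟨Q, hQ, fun p hp v => ?_⟩
  have := hz p hp v
  simpa only [h2, h3] using this

/-! ### The line spanned by the four points of a relation -/

/-- If all components of a non-zero Abelian relation vanish at `p`, those along the first net have
non-zero derivatives there, because the jet at `p` is `(0, 0, y)` with `y ≠ 0`. -/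
lemma frequently_ne_zero_first_net (hconn : IsConnected U) (hN₂ : IsOrthogonalNet U N₂)
    (hweb : IsWeb U (webOfNets N₁ N₂)) (hflat : IsConformallyFlat U N₁)
    {τ : Fin 4 → ℂ → ℂ →L[ℝ] ℝ} (hτ : τ ∈ abelianRelations U (webOfNets N₁ N₂) hU)
    (hne : τ ≠ 0) {p : ℂ} (hp : p ∈ U) (h0 : ∀ i, τ i p = 0) :
    (∃ᶠ z in 𝓝 p, τ 0 z ≠ 0) ∧ ∃ᶠ z in 𝓝 p, τ 1 z ≠ 0 := by
  obtain ⟨V, h, k, hpV, H⟩ := exists_adapted_chart hN₂ hflat hp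
  have hc : ∀ i c, frameComp h i c τ p = 0 := fun i c => by simp [frameComp, h0 i]
  have hy : frameJet h k τ p ≠ 0 := fun hy =>
    hne (H.eq_zero_of_jet hconn hN₂ hweb hflat hτ hpV (hc 0 1) (hc 1 I) hy)
  have hev : ∀ i c, (¬ ∃ᶠ z in 𝓝 p, τ i z ≠ 0) → ∀ᶠ z in 𝓝 p, frameComp h i c τ z = 0 := by
    intro i c hz
    rw [not_frequently] at hz
    exact hz.mono fun z hz => by simp [frameComp, not_not.1 hz]
  constructor
  · by_contra hz
    apply hy
    rw [frameJet, frameDeriv_eq_zero_of_eventuallyEq (hev 0 1 hz), hc]; simp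
  · by_contra hz
    apply hy
    rw [H.frameJet_eq hweb hτ hpV, frameDeriv_eq_zero_of_eventuallyEq (hev 1 I hz), hc]; simp

lemma frequently_ne_zero (hconn : IsConnected U) (hN₁ : IsOrthogonalNet U N₁)
    (hN₂ : IsOrthogonalNet U N₂) (hweb : IsWeb U (webOfNets N₁ N₂))
    (hflat₁ : IsConformallyFlat U N₁) (hflat₂ : IsConformallyFlat U N₂)
    {τ : Fin 4 → ℂ → ℂ →L[ℝ] ℝ} (hτ : τ ∈ abelianRelations U (webOfNets N₁ N₂) hU)
    (hne : τ ≠ 0) {p : ℂ} (hp : p ∈ U) (h0 : ∀ i, τ i p = 0) (i : Fin 4) :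
    ∃ᶠ z in 𝓝 p, τ i z ≠ 0 := by
  have h1 := frequently_ne_zero_first_net hconn hN₂ hweb hflat₁ hτ hne hp h0
  have h2 := frequently_ne_zero_first_net hconn hN₁ hweb.swap hflat₂
    (mem_abelianRelations_swap hτ) (fun h => hne (funext fun i => by
      simpa using congrFun h (i - 2))) hp (fun i => h0 _)
  fin_cases i
  exacts [h1.1, h1.2, h2.1, h2.2]

/-- Over a point `p` the four points of the arcs lie on a line, spanned by `x` and `y`, and they are
pairwise distinct. The line is the kernel of `r`, that is, `r` is the Abelian relation vanishing
at `p`. -/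
lemma exists_line_of_arcs (hconn : IsConnected U) (hN₂ : IsOrthogonalNet U N₂)
    (hweb : IsWeb U (webOfNets N₁ N₂)) (hflat : IsConformallyFlat U N₁)
    (hθ : ∀ α, θ α ∈ abelianRelations U (webOfNets N₁ N₂) hU) (hli : LinearIndependent ℝ θ)
    {p : ℂ} (hp : p ∈ U) :
    ∃ (x y r : Fin 3 → ℝ) (m n : Fin 4 → ℝ) (v : Fin 4 → ℂ),
      (∀ i, (fun α => θ α i p (v i)) = m i • x + n i • y) ∧
      (∀ i j, i ≠ j → m i * n j ≠ m j * n i) ∧ (∀ i, m i = 0 → n i ≠ 0) ∧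
      r ≠ 0 ∧ (∀ i, (∑ α, r α • θ α) i p = 0) ∧
      ∀ z : Fin 3 → ℝ, ∑ α, r α * z α = 0 → ∃ s t : ℝ, z = s • x + t • y := by
  obtain ⟨V, h, k, hpV, H⟩ := exists_adapted_chart hN₂ hflat hp
  have hu := H.isUnit_jetMatrix hconn hN₂ hweb hflat hθ hli hpV
  set M := jetMatrix h k θ p with hM
  have hMM : M * M⁻¹ = 1 := Matrix.mul_nonsing_inv M ((Matrix.isUnit_iff_isUnit_det M).1 hu)
  set r : Fin 3 → ℝ := fun α => M⁻¹ α 2 with hr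
  have hdual : ∀ i, ∑ α, M i α * r α = (1 : Matrix (Fin 3) (Fin 3) ℝ) i 2 := fun i => by
    rw [← hMM, Matrix.mul_apply]
  have hcomb := combination_mem hθ r
  have ha : frameComp h 0 1 (∑ α, r α • θ α) p = 0 := by
    rw [frameComp_combination]
    refine Eq.trans (Finset.sum_congr rfl fun α _ => mul_comm _ _) ((hdual 0).trans ?_)
    simp
  have hb : frameComp h 1 I (∑ α, r α • θ α) p = 0 := by
    rw [frameComp_combination]
    refine Eq.trans (Finset.sum_congr rfl fun α _ => mul_comm _ _) ((hdual 1).trans ?_)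
    simp
  have hN := H.normSq_div_ne hpV
  have hre := H.re_div_ne hweb hpV
  have him := H.im_div_ne hweb hpV
  set c := (k p / h p).re
  set s := (k p / h p).im
  refine ⟨M 0, M 1, r, ![1, 0, -c / (c ^ 2 + s ^ 2), -s / (c ^ 2 + s ^ 2)],
    ![0, 1, s / (c ^ 2 + s ^ 2), -c / (c ^ 2 + s ^ 2)],
    ![1 / h p, I / h p, 1 / k p, I / k p], ?_, ?_, ?_, ?_, ?_, ?_⟩
  · intro i
    funext α
    obtain ⟨e2, e3⟩ := H.comp_two_three (hθ α) hpV
    rw [← eq_div_iff hN] at e2 e3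
    fin_cases i
    · simp [hM, jetMatrix, frameComp]
    · simp [hM, jetMatrix, frameComp]
    · change θ α 2 p (1 / k p) = -c / (c ^ 2 + s ^ 2) * frameComp h 0 1 (θ α) p
        + s / (c ^ 2 + s ^ 2) * frameComp h 1 I (θ α) p
      rw [e2]; ring
    · change θ α 3 p (I / k p) = -s / (c ^ 2 + s ^ 2) * frameComp h 0 1 (θ α) p
        + -c / (c ^ 2 + s ^ 2) * frameComp h 1 I (θ α) p
      rw [e3]; ring
  · -- The determinants are, up to sign, `1`, `c / N`, `s / N` and `1 / N` with `N = c² + s²`.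
    have key : ∀ i j : Fin 4, i < j →
        (![1, 0, -c / (c ^ 2 + s ^ 2), -s / (c ^ 2 + s ^ 2)] : Fin 4 → ℝ) i
          * (![0, 1, s / (c ^ 2 + s ^ 2), -c / (c ^ 2 + s ^ 2)] : Fin 4 → ℝ) j
        ≠ (![1, 0, -c / (c ^ 2 + s ^ 2), -s / (c ^ 2 + s ^ 2)] : Fin 4 → ℝ) j
          * (![0, 1, s / (c ^ 2 + s ^ 2), -c / (c ^ 2 + s ^ 2)] : Fin 4 → ℝ) i := by
      have h23 : -c / (c ^ 2 + s ^ 2) * (-c / (c ^ 2 + s ^ 2))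
          ≠ -s / (c ^ 2 + s ^ 2) * (s / (c ^ 2 + s ^ 2)) := by
        intro h
        apply hN
        field_simp at h
        linarith
      intro i j hij
      fin_cases i <;> fin_cases j <;> first
        | exact absurd hij (by decide)
        | exact h23
        | simp [hN, hre, him, Ne.symm]
    intro i j hij
    rcases lt_or_gt_of_ne hij with h | h
    · exact key i j h
    · exact (key j i h).symm
  · intro i
    fin_cases i <;> simp [hN, hre, him]
  · intro h0
    have := hdual 2
    rw [h0] at this
    simp at this
  · have hz : ∀ w, (∑ α, r α • θ α) 0 p w = 0 ∧ (∑ α, r α • θ α) 1 p w = 0 := fun w =>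
      ⟨by rw [H.apply_zero hcomb hpV, ha, mul_zero], by rw [H.apply_one hcomb hpV, hb, mul_zero]⟩
    obtain ⟨e2, e3⟩ := H.comp_two_three hcomb hpV
    rw [ha, hb, mul_zero, mul_zero, add_zero, mul_eq_zero, or_iff_left hN] at e2
    rw [ha, hb, mul_zero, mul_zero, sub_zero, mul_eq_zero, or_iff_left hN] at e3
    intro i
    ext w
    fin_cases i
    · exact (hz w).1
    · exact (hz w).2
    · exact (H.apply_two hcomb hpV w).trans (by rw [e2, mul_zero]; rfl)
    · exact (H.apply_three hcomb hpV w).trans (by rw [e3, mul_zero]; rfl)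
  · intro z hz
    have hsurj : Matrix.vecMul (Matrix.vecMul z M⁻¹) M = z := by
      rw [Matrix.vecMul_vecMul, Matrix.nonsing_inv_mul M ((Matrix.isUnit_iff_isUnit_det M).1 hu),
        Matrix.vecMul_one]
    have h2 : Matrix.vecMul z M⁻¹ 2 = 0 := by
      rw [← hz, Matrix.vecMul, dotProduct]
      exact Finset.sum_congr rfl fun α _ => mul_comm _ _
    refine ⟨Matrix.vecMul z M⁻¹ 0, Matrix.vecMul z M⁻¹ 1, ?_⟩
    funext α
    have := congrFun hsurj α
    rw [Matrix.vecMul, dotProduct, Fin.sum_univ_three, h2, zero_mul, add_zero] at this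
    exact this.symm

end Swap

/-! ### Uniqueness of the quartic -/

section Uniqueness

open MvPolynomial

variable {U : Set ℂ} {hU : IsOpen U} {W : Fin 4 → DirectionField}
  {θ : Fin 3 → Fin 4 → ℂ → ℂ →L[ℝ] ℝ}

/-- The components `θ α i` at a point are multiples of one covector, hence the vectors
`α ↦ θ α i z v` for different `v` represent the same point of the projective plane. -/
lemma exists_smul_eq_of_foliation {D : DirectionField} (hD : IsFoliation U D) {z : ℂ} (hz : z ∈ U)
    {i : Fin 4} (hθ : ∀ α, ∀ v ∈ D z, θ α i z v = 0) {w : ℂ} (hw : w ∉ D z) (v : ℂ) :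
    ∃ t : ℝ, (fun α => θ α i z v) = t • fun α => θ α i z w := by
  obtain ⟨V, -, hzV, -, η, -, hη⟩ := hD z hz
  have hker := (hη z hzV).2
  have hw0 : η z w ≠ 0 := fun h => hw ((hker w).2 h)
  refine ⟨η z v / η z w, funext fun α => ?_⟩
  have h1 : v - (η z v / η z w) • w ∈ D z := by
    rw [hker, map_sub, map_smul, smul_eq_mul, div_mul_cancel₀ _ hw0, sub_self]
  have h2 := hθ α _ h1
  rw [map_sub, map_smul] at h2
  exact sub_eq_zero.1 h2

/-- If `λG` vanishes along the `i`-th arc, where `λ` is an Abelian relation whose `i`-th component is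
not identically zero near `p`, then `G` vanishes at the point of the arc over `p`. -/
lemma eval_eq_zero_of_mul (hW : ∀ i, IsFoliation U (W i))
    (hθ : ∀ α, θ α ∈ abelianRelations U W hU) {p : ℂ} (hp : p ∈ U) {r : Fin 3 → ℝ} {i : Fin 4}
    (hfreq : ∃ᶠ z in 𝓝 p, (∑ α, r α • θ α) i z ≠ 0) {d : ℕ} {G : MvPolynomial (Fin 3) ℝ}
    (hG : G.IsHomogeneous d)
    (hz : ∀ z ∈ U, ∀ w, (∑ α, r α • θ α) i z w * eval (fun α => θ α i z w) G = 0) (v : ℂ) :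
    eval (fun α => θ α i p v) G = 0 := by
  have hcont : ContinuousAt (fun z => eval (fun α => θ α i z v) G) p := by
    refine (continuous_eval G).continuousAt.comp (continuousAt_pi.2 fun α => ?_)
    have := (((hθ α).1 i).continuousOn.continuousAt (hU.mem_nhds hp))
    exact this.clm_apply continuousAt_const
  by_contra hne
  refine hfreq ?_
  filter_upwards [hcont.eventually_ne hne, hU.eventually_mem hp] with z hz1 hzU hz2
  apply hz2
  ext w
  rw [zero_apply]
  by_contra hw
  have hwD : w ∉ W i z := fun h => hw ((combination_mem hθ r).2.2.1 i z hzU w h)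
  obtain ⟨t, ht⟩ := exists_smul_eq_of_foliation (hW i) hzU
    (fun α v hv => (hθ α).2.2.1 i z hzU v hv) hwD v
  apply hz1
  rw [ht, eval_smul_of_isHomogeneous hG, (mul_eq_zero.1 (hz z hzU w)).resolve_left hw, mul_zero]

lemma eval_linear_apply (r : Fin 3 → ℝ) (i : Fin 4) (z w : ℂ) :
    eval (fun α => θ α i z w) (∑ α, C (r α) * X α) = (∑ α, r α • θ α) i z w := by
  simp [Finset.sum_apply]

/-- A form of degree at most three is zero if it vanishes on the four arcs: it vanishes at four
points of a line, hence on the line, and its quotient by the equation of the line again vanishes on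
the arcs. -/
lemma eq_zero_of_degree_le_three (hW : ∀ i, IsFoliation U (W i))
    (hθ : ∀ α, θ α ∈ abelianRelations U W hU) {p : ℂ} (hp : p ∈ U) {x y r : Fin 3 → ℝ}
    {m n : Fin 4 → ℝ} {v : Fin 4 → ℂ} (hv : ∀ i, (fun α => θ α i p (v i)) = m i • x + n i • y)
    (hdet : ∀ i j, i ≠ j → m i * n j ≠ m j * n i) (hne : ∀ i, m i = 0 → n i ≠ 0) (hr : r ≠ 0)
    (hplane : ∀ z : Fin 3 → ℝ, ∑ α, r α * z α = 0 → ∃ s t : ℝ, z = s • x + t • y)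
    (hfreq : ∀ i, ∃ᶠ z in 𝓝 p, (∑ α, r α • θ α) i z ≠ 0) (d : ℕ) (hd : d ≤ 3) :
    ∀ G : MvPolynomial (Fin 3) ℝ, G.IsHomogeneous d →
      (∀ i, ∀ z ∈ U, ∀ w, (∑ α, r α • θ α) i z w * eval (fun α => θ α i z w) G = 0) →
      G = 0 := by
  induction d with
  | zero =>
    intro G hG hz
    have h0 := eval_eq_zero_of_mul hW hθ hp (hfreq 0) hG (hz 0) 0
    have hC := (totalDegree_eq_zero_iff_eq_C (p := G)).1
      ((totalDegree_zero_iff_isHomogeneous _).2 hG)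
    rw [hC, eval_C] at h0
    rw [hC, h0, C_0]
  | succ d ih =>
    intro G hG hz
    have hpt : ∀ i, eval (m i • x + n i • y) G = 0 := fun i => by
      rw [← hv i]
      exact eval_eq_zero_of_mul hW hθ hp (hfreq i) hG (hz i) (v i)
    obtain ⟨G', hG', rfl⟩ := exists_eq_linear_mul hG hr fun z hz0 => by
      obtain ⟨s, t, rfl⟩ := hplane z hz0
      exact eval_eq_zero_of_card_lt hG x y m n hne hdet (by simp; omega) hpt s t
    rw [ih (by omega) G' hG' ?_, mul_zero]
    intro i z hzU w
    have := hz i z hzU w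
    rw [map_mul, eval_linear_apply, ← mul_assoc, mul_eq_zero, mul_self_eq_zero] at this
    exact mul_eq_zero.2 this

/-- There is a point `e` such that a quartic form that vanishes on the four arcs and at `e` is
zero: `e` is any further point on the line through the four points over `p`. -/
lemma exists_point_quartic_eq_zero (hW : ∀ i, IsFoliation U (W i))
    (hθ : ∀ α, θ α ∈ abelianRelations U W hU) {p : ℂ} (hp : p ∈ U) {x y r : Fin 3 → ℝ}
    {m n : Fin 4 → ℝ} {v : Fin 4 → ℂ} (hv : ∀ i, (fun α => θ α i p (v i)) = m i • x + n i • y)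
    (hdet : ∀ i j, i ≠ j → m i * n j ≠ m j * n i) (hne : ∀ i, m i = 0 → n i ≠ 0) (hr : r ≠ 0)
    (hplane : ∀ z : Fin 3 → ℝ, ∑ α, r α * z α = 0 → ∃ s t : ℝ, z = s • x + t • y)
    (hfreq : ∀ i, ∃ᶠ z in 𝓝 p, (∑ α, r α • θ α) i z ≠ 0) :
    ∃ e : Fin 3 → ℝ, ∀ G : MvPolynomial (Fin 3) ℝ, G.IsHomogeneous 4 →
      (∀ i, ∀ z ∈ U, ∀ w, eval (fun α => θ α i z w) G = 0) → eval e G = 0 → G = 0 := by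
  classical
  obtain ⟨τ, hτ⟩ := Infinite.exists_notMem_finset (Finset.univ.image fun i => n i / m i)
  have hτ' : ∀ i, m i * τ ≠ n i := by
    intro i h0
    by_cases hm : m i = 0
    · exact hne i hm (by rw [hm] at h0; linarith)
    · exact hτ (Finset.mem_image.2 ⟨i, Finset.mem_univ _, by field_simp; linarith⟩)
  refine ⟨x + τ • y, fun G hG hz he => ?_⟩
  obtain ⟨G', hG', rfl⟩ := exists_eq_linear_mul (d := 3) hG hr fun z hz0 => by
    obtain ⟨s, t, rfl⟩ := hplane z hz0
    refine eval_eq_zero_of_card_lt hG x y (fun i : Option (Fin 4) => i.elim 1 m)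
      (fun i => i.elim τ n) ?_ ?_ (by simp) ?_ s t
    · rintro (_ | i)
      · exact fun h => absurd h one_ne_zero
      · exact hne i
    · rintro (_ | i) (_ | j) hij
      · exact absurd rfl hij
      · simpa using (hτ' j).symm
      · simpa using hτ' i
      · exact hdet i j fun h => hij (by rw [h])
    · rintro (_ | i)
      · simpa using he
      · change eval (m i • x + n i • y) G = 0
        rw [← hv i]
        exact hz i p hp (v i)
  rw [eq_zero_of_degree_le_three hW hθ hp hv hdet hne hr hplane hfreq 3 le_rfl G' hG' ?_, mul_zero]
  intro i z hzU w
  rw [← eval_linear_apply, ← map_mul]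
  exact hz i z hzU w

end Uniqueness

/-! ### Conformal flatness and the rank quartic -/

lemma linearIndependent_coe_basis {E ι : Type*} [AddCommGroup E] [Module ℝ E] {S : Submodule ℝ E}
    (b : Module.Basis ι ℝ S) : LinearIndependent ℝ fun α => (b α : E) :=
  b.linearIndependent.map' S.subtype S.ker_subtype

lemma nonempty_basis_of_finrank_eq_succ {E : Type*} [AddCommGroup E] [Module ℝ E]
    {S : Submodule ℝ E} {n : ℕ} (h : Module.finrank ℝ S = n + 1) :
    Nonempty (Module.Basis (Fin (n + 1)) ℝ S) :=
  have : Module.Finite ℝ S := Module.finite_of_finrank_pos (by omega)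
  ⟨Module.finBasisOfFinrankEq ℝ S h⟩

theorem theorem4 (U : Set ℂ) (hU : IsOpen U) (hconn : IsConnected U)
    (N₁ N₂ : Fin 2 → DirectionField)
    (hN₁ : IsOrthogonalNet U N₁) (hN₂ : IsOrthogonalNet U N₂)
    (hweb : IsWeb U (webOfNets N₁ N₂))
    (hrank : webRank U (webOfNets N₁ N₂) hU = 3)
    (hflat : IsConformallyFlat U N₁) :
    IsConformallyFlat U N₂ ∧
      ∀ b : Module.Basis (Fin 3) ℝ (abelianRelations U (webOfNets N₁ N₂) hU),
        ∃ Q₁ Q₂ : MvPolynomial (Fin 3) ℝ, IsConic Q₁ ∧ IsConic Q₂ ∧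
          ∀ F : MvPolynomial (Fin 3) ℝ,
            IsRankQuartic U (webOfNets N₁ N₂) hU b F ↔
              ∃ c : ℝ, c ≠ 0 ∧ F = MvPolynomial.C c * (Q₁ * Q₂) := by
  have hli : ∀ b : Module.Basis (Fin 3) ℝ (abelianRelations U (webOfNets N₁ N₂) hU),
      LinearIndependent ℝ fun α => (b α : Fin 4 → ℂ → ℂ →L[ℝ] ℝ) :=
    linearIndependent_coe_basis
  have hflat₂ : IsConformallyFlat U N₂ := by
    obtain ⟨b⟩ := nonempty_basis_of_finrank_eq_succ hrank
    exact isConformallyFlat_second_net hconn hN₂ hweb hflat (fun α => (b α).2) (hli b)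
  refine ⟨hflat₂, fun b => ?_⟩
  obtain ⟨p, hp⟩ := hconn.nonempty
  obtain ⟨Q₁, hQ₁, hz₁⟩ := exists_conic_of_first_net hconn hN₂ hweb hflat (fun α => (b α).2) (hli b)
  obtain ⟨Q₂, hQ₂, hz₂⟩ := exists_conic_of_second_net hconn hN₁ hweb hflat₂
    (fun α => (b α).2) (hli b)
  obtain ⟨x, y, r, m, n, v, hv, hdet, hne, hr, hr0, hplane⟩ :=
    exists_line_of_arcs hconn hN₂ hweb hflat (fun α => (b α).2) (hli b) hp
  have hrel : ∑ α, r α • (b α : Fin 4 → ℂ → ℂ →L[ℝ] ℝ) ≠ 0 := fun h =>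
    hr (funext (Fintype.linearIndependent_iff.1 (hli b) r h))
  obtain ⟨e, he⟩ := exists_point_quartic_eq_zero hweb.foliation (fun α => (b α).2) hp hv hdet hne hr
    hplane (frequently_ne_zero hconn hN₁ hN₂ hweb hflat hflat₂
      (combination_mem (fun α => (b α).2) r) hrel hp hr0)
  have hhom : (Q₁ * Q₂).IsHomogeneous 4 := hQ₁.1.mul hQ₂.1
  have hQ0 : Q₁ * Q₂ ≠ 0 := mul_ne_zero hQ₁.2 hQ₂.2
  have harc : ∀ i, ∀ q ∈ U, ∀ w, MvPolynomial.eval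
      (fun α => (b α : Fin 4 → ℂ → ℂ →L[ℝ] ℝ) i q w) (Q₁ * Q₂) = 0 := by
    intro i q hq w
    rw [map_mul, mul_eq_zero]
    match i with
    | 0 => exact Or.inl (hz₁ q hq w).1
    | 1 => exact Or.inl (hz₁ q hq w).2
    | 2 => exact Or.inr (hz₂ q hq w).1
    | 3 => exact Or.inr (hz₂ q hq w).2
  have heQ : MvPolynomial.eval e (Q₁ * Q₂) ≠ 0 := fun h => hQ0 (he _ hhom harc h)
  refine ⟨Q₁, Q₂, hQ₁, hQ₂, fun F => ⟨?_, ?_⟩⟩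
  · rintro ⟨hF, hF0, hFz⟩
    set c := MvPolynomial.eval e F / MvPolynomial.eval e (Q₁ * Q₂) with hc
    have hFc : F - MvPolynomial.C c * (Q₁ * Q₂) = 0 := by
      refine he _ (hF.sub (hhom.C_mul c)) (fun i q hq w => ?_) ?_
      · rw [map_sub, map_mul, hFz i q hq w, harc i q hq w, mul_zero, sub_zero]
      · rw [map_sub, map_mul, MvPolynomial.eval_C, hc, div_mul_cancel₀ _ heQ, sub_self]
    refine ⟨c, fun h0 => hF0 ?_, sub_eq_zero.1 hFc⟩
    rw [sub_eq_zero.1 hFc, h0, MvPolynomial.C_0, zero_mul]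
  · rintro ⟨c, hc, rfl⟩
    refine ⟨hhom.C_mul c, mul_ne_zero (MvPolynomial.C_ne_zero.2 hc) hQ0, fun i q hq w => ?_⟩
    rw [map_mul, harc i q hq w, mul_zero]
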